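/- Let $r\ge 0$ and let $f=\sum_{\lambda\in\mathcal L}a_\lambda t^\lambda\in\mathbb C[t_1^{\pm1},\dots,t_r^{\pm1}]$ be any Laurent polynomial, where $\mathcal L\subset\mathbb Z^r$ is finite and every $a_\lambda\neq 0$. Let $V(f)\subset(\mathbb C^*)^r$ be its zero set, and for $n\ge1$ let $p_{V(f)}(n)$ be the number of $x\in V(f)$ with $x^n=1$. A *rational plane* is a set $\eta H$, where $H\subset(\mathbb C^*)^r$ is a connected algebraic subgroup and $\eta\in(\mathbb C^*)^r$ has finite order. **Subgroups.** For a subgroup $\varepsilon\subset\mathbb Z^r$ put $V(\varepsilon)=\{x\in(\mathbb C^*)^r: x^\lambda=1\ \forall\lambda\in\varepsilon\}$ and $\overline\varepsilon=\{\lambda\in\mathbb Z^r:\exists n\ge1,\ n\lambda\in\varepsilon\}$ (the saturation of $\varepsilon$). For a finite abelian group $G$ let $D(G)$ be the largest order of an element of $G$. **Partitions.** Let $\Pi_f$ be the set of partitions $\mathcal P$ of $\mathcal L$ all of whose blocks have at least two elements. For $\mathcal P\in\Pi_f$ let $\varepsilon(\mathcal P,f)\subset\mathbb Z^r$ be the subgroup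 generated by all $\lambda-\mu$ with $\lambda,\mu$ in a common block of $\mathcal P$. For $\mathcal U\subset\Pi_f$ let $\varepsilon(\mathcal U,f)$ be the subgroup generated by all $\varepsilon(\mathcal P,f)$, $\mathcal P\in\mathcal U$. Put $$D(f)=\operatorname{lcm}\{D(\overline{\varepsilon(\mathcal U,f)}/\varepsilon(\mathcal U,f)):\mathcal U\subset\Pi_f\}.$$ **Torsion solutions.** For $\mathcal P\in\Pi_f$ choose $\lambda_\nu\in\nu$ in every block $\nu$, put $\nu^*=\nu\setminus\{\lambda_\nu\}$, and define monomial maps $$\beta_{\mathcal P}:(\mathbb C^*)^{\mathcal L}\to\prod_{\nu\in\mathcal P}(\mathbb C^*)^{\nu^*},\quad (y_\lambda)\mapsto(y_\lambda/y_{\lambda_\nu})_{\lambda\in\nu^*,\,\nu\in\mathcal P},\qquad \psi_{\mathcal P,f}(x)=\beta_{\mathcal P}\big((x^\lambda)_{\lambda\in\mathcal L}\big).$$ Let $\mathcal T(\mathcal P,f)$ be the set of $y\in(\mathbb C^*)^{\mathcal L}$ with $\sum_{\lambda\in\nu}a_\lambda y_\lambda=0$ for all $\nu\in\mathcal P$.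 Let $S(\mathcal P,f)$ be the set of finite-order points $z\in\prod_\nu(\mathbb C^*)^{\nu^*}$ such that $\sum_{\lambda\in\nu^*}(-a_\lambda/a_{\lambda_\nu})z_\lambda=1$ for all $\nu\in\mathcal P$, and such that $\beta_{\mathcal P}^{-1}(z)$ is disjoint from $\mathcal T(\mathcal P',f)$ for every proper refinement $\mathcal P'\in\Pi_f$ of $\mathcal P$. Let $\delta_{\mathcal P,f}=1$ if $\psi_{\mathcal P,f}^{-1}(S(\mathcal P,f))\ne\emptyset$ and $\delta_{\mathcal P,f}=0$ otherwise. Let $M(\mathcal P,f)$ be the least common multiple of the orders of the elements of $S(\mathcal P,f)$ ($1$ if $S(\mathcal P,f)=\emptyset$), and $M(f)=\operatorname{lcm}_{\mathcal P\in\Pi_f}M(\mathcal P,f)$. **Proposition.** For every choice of the $\lambda_\nu$: 1. every maximal (under inclusion) rational plane contained in $V(f)$ is a translate of $V(\overline{\varepsilon(\mathcal P,f)})$ for some $\mathcal P\in\Pi_f$; 2. every $S(\mathcal P,f)$ is finite (so that $M(f)$ is well defined), and $p_{V(f)}$ is polynomial periodic: $p_{V(f)}(n)=\sum_{i=0}^d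 a_i(n)n^i$ for all $n\ge1$, with periodic functions $a_i:\mathbb N\to\mathbb C$; 3. for every such expression, let $\deg(p_{V(f)})$ be the largest $i$ such that $a_i$ is not identically zero ($0$ if there is none), and let $\operatorname{per}(p_{V(f)})$ be the least common multiple of the least periods of the $a_i$. Then $$\deg(p_{V(f)})=\max_{\mathcal P\in\Pi_f}\big(r-\operatorname{rank}\overline{\varepsilon(\mathcal P,f)}\big)\,\delta_{\mathcal P,f}$$ (the maximum over the empty set being $0$), and $$\operatorname{per}(p_{V(f)})\ \big|\ M(f)\,D(f).$$ -/

import Mathlib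

noncomputable section

namespace TorusTorsion

/-! ### The affine torus, Laurent polynomials and algebraic subsets -/

/-- The affine torus `(ℂˣ)^r`, with coordinatewise multiplication. -/
abbrev Torus (r : ℕ) : Type := Fin r → ℂˣ

/-- Laurent polynomials in `r` variables over `ℂ`, that is, the group ring of `ℤ^r`. -/
abbrev Laurent (r : ℕ) : Type := AddMonoidAlgebra ℂ (Fin r → ℤ)

/-- The set of exponents occurring in `f` with a nonzero coefficient. -/
abbrev exponents {r : ℕ} (f : Laurent r) : Finset (Fin r → ℤ) := f.coeff.support

/-- The value `x^l = ∏ x_i ^ l_i` of a Laurent monomial. -/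
def monomialValue {r : ℕ} (x : Torus r) (l : Fin r → ℤ) : ℂˣ := ∏ i, x i ^ l i

/-- The value of a Laurent polynomial at a point of the torus. -/
def evalAt {r : ℕ} (f : Laurent r) (x : Torus r) : ℂ :=
  ∑ l ∈ exponents f, f.coeff l * (monomialValue x l : ℂ)

/-- The common zero set of a set of Laurent polynomials. -/
def zeroLocus {r : ℕ} (F : Set (Laurent r)) : Set (Torus r) := {x | ∀ f ∈ F, evalAt f x = 0}

/-- The hypersurface `V(f)`. -/
def hypersurface {r : ℕ} (f : Laurent r) : Set (Torus r) := {x | evalAt f x = 0}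

/-- Algebraic (Zariski closed) subsets of the torus. -/
def IsAlgebraicSet {r : ℕ} (A : Set (Torus r)) : Prop := ∃ F : Set (Laurent r), A = zeroLocus F

/-- Connectedness in the Zariski topology, for an algebraic set: it is not the union of two
disjoint nonempty algebraic sets. -/
def IsZariskiConnected {r : ℕ} (A : Set (Torus r)) : Prop :=
  ∀ B C : Set (Torus r), IsAlgebraicSet B → IsAlgebraicSet C → A = B ∪ C → Disjoint B C →
    B = ∅ ∨ C = ∅

/-- An affine subtorus: a connected algebraic subgroup of the torus. -/
def IsAffineSubtorus {r : ℕ} (H : Subgroup (Torus r)) : Prop :=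
  IsAlgebraicSet (H : Set (Torus r)) ∧ IsZariskiConnected (H : Set (Torus r))

/-- The translate `η A`. -/
def torusTranslate {r : ℕ} (η : Torus r) (A : Set (Torus r)) : Set (Torus r) := (fun x => η * x) '' A

/-- A rational plane: a translate of an affine subtorus by an element of finite order. -/
def IsRationalPlane {r : ℕ} (Q : Set (Torus r)) : Prop :=
  ∃ (H : Subgroup (Torus r)) (η : Torus r),
    IsAffineSubtorus H ∧ IsOfFinOrder η ∧ Q = torusTranslate η (H : Set (Torus r))

/-- The inclusion-maximal elements among the rational planes contained in `A`. -/
def IsMaximalRationalPlaneIn {r : ℕ} (Q A : Set (Torus r)) : Prop :=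
  Maximal (fun Q' : Set (Torus r) => IsRationalPlane Q' ∧ Q' ⊆ A) Q

/-! ### Subgroups of `ℤ^r` -/

/-- `V(E)`: the points of the torus at which all binomials `t^l - 1`, `l ∈ E`, vanish. -/
def subgroupLocus {r : ℕ} (E : AddSubgroup (Fin r → ℤ)) : Set (Torus r) :=
  {x | ∀ l ∈ E, monomialValue x l = 1}

/-- The saturation of `E`: the `l` with `n l ∈ E` for some positive integer `n`. -/
def saturation {r : ℕ} (E : AddSubgroup (Fin r → ℤ)) : AddSubgroup (Fin r → ℤ) where
  carrier := {l | ∃ n : ℕ, 0 < n ∧ n • l ∈ E}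
  zero_mem' := ⟨1, one_pos, by simp⟩
  add_mem' := by
    rintro a b ⟨m, hm, ha⟩ ⟨n, hn, hb⟩
    refine ⟨m * n, Nat.mul_pos hm hn, ?_⟩
    rw [smul_add]
    refine E.add_mem ?_ ?_
    · rw [mul_comm, mul_smul]
      exact E.nsmul_mem ha n
    · rw [mul_smul]
      exact E.nsmul_mem hb m
  neg_mem' := by
    rintro a ⟨m, hm, ha⟩
    exact ⟨m, hm, by rw [smul_neg]; exact E.neg_mem ha⟩

/-- The rank of a subgroup of `ℤ^r`. -/
def rank {r : ℕ} (E : AddSubgroup (Fin r → ℤ)) : ℕ := Module.finrank ℤ E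

/-- The largest order of an element of the finite group `saturation E / E`. -/
def maxOrderSatQuot {r : ℕ} (E : AddSubgroup (Fin r → ℤ)) : ℕ :=
  ⨆ g : saturation E ⧸ E.addSubgroupOf (saturation E), addOrderOf g

/-! ### Partitions of the exponent set and the associated linear equations -/

section Partitions

variable {r : ℕ}

/-- `Π_f`: the partitions of the exponent set all of whose blocks have at least two elements. -/
abbrev AdmissiblePartition (f : Laurent r) : Type :=
  {P : Finpartition (exponents f) // ∀ ν ∈ P.parts, 2 ≤ ν.card}

variable {f : Laurent r}

/-- The blocks of a partition. -/
abbrev Block (P : AdmissiblePartition f) : Type := {ν : Finset (Fin r → ℤ) // ν ∈ P.1.parts}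

/-- A choice of a base exponent in every block. -/
abbrev BaseChoice (P : AdmissiblePartition f) : Type := (ν : Block P) → {l // l ∈ ν.1}

/-- A member of a block, as an exponent of `f`. -/
def Block.toExponent {P : AdmissiblePartition f} (ν : Block P) (l : {l // l ∈ ν.1}) :
    {l // l ∈ exponents f} := ⟨l.1, P.1.le ν.2 l.2⟩

/-- `ε(P, f)`: the subgroup generated by the differences of exponents lying in a common block. -/
def differenceGroup (P : AdmissiblePartition f) : AddSubgroup (Fin r → ℤ) :=
  AddSubgroup.closure {d | ∃ ν ∈ P.1.parts, ∃ l ∈ ν, ∃ m ∈ ν, d = l - m}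

/-- `ε(U, f)`: the subgroup generated by the `ε(P, f)` with `P ∈ U`. -/
def differenceGroupOfSet (U : Finset (AdmissiblePartition f)) : AddSubgroup (Fin r → ℤ) :=
  AddSubgroup.closure (⋃ P ∈ U, (differenceGroup P : Set (Fin r → ℤ)))

/-- The torus `∏_ν (ℂˣ)^ν = (ℂˣ)^{exponents f}`. -/
abbrev BigTorus (f : Laurent r) : Type := {l // l ∈ exponents f} → ℂˣ

/-- The torus `∏_ν (ℂˣ)^{ν^*}`, where `ν^*` is the block `ν` without its base exponent. -/
abbrev ReducedTorus (P : AdmissiblePartition f) (c : BaseChoice P) : Type :=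
  (ν : Block P) → {l : {l // l ∈ ν.1} // l ≠ c ν} → ℂˣ

/-- The monomial map `x ↦ (x^l)_l`. -/
def alpha (f : Laurent r) (x : Torus r) : BigTorus f := fun l => monomialValue x l.1

/-- The monomial map dividing each coordinate by the base coordinate of its block. -/
def beta (P : AdmissiblePartition f) (c : BaseChoice P) (y : BigTorus f) : ReducedTorus P c :=
  fun ν l => y (ν.toExponent l.1) / y (ν.toExponent (c ν))

/-- The composite monomial map, `x ↦ (x^(l - base exponent of the block of l))_l`. -/
def psi (P : AdmissiblePartition f) (c : BaseChoice P) (x : Torus r) : ReducedTorus P c :=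
  beta P c (alpha f x)

/-- The solutions of the homogeneous system, with one equation `∑_{l ∈ ν} a_l y_l = 0` for every
block `ν`. -/
def homogeneousSolutions (P : AdmissiblePartition f) : Set (BigTorus f) :=
  {y | ∀ ν : Block P, ∑ l : {l // l ∈ ν.1}, f.coeff l.1 * (y (ν.toExponent l) : ℂ) = 0}

open Classical in
/-- The solutions of the inhomogeneous system, with one equation
`∑_{l ∈ ν^*} (-a_l / a_base) x_l = 1` for every block `ν`. -/
def solutions (P : AdmissiblePartition f) (c : BaseChoice P) : Set (ReducedTorus P c) :=
  {x | ∀ ν : Block P,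
    ∑ l : {l : {l // l ∈ ν.1} // l ≠ c ν}, (-f.coeff l.1.1 / f.coeff (c ν).1) * (x ν l : ℂ) = 1}

/-- The solutions for `P` that do not come from a proper refinement `P'` of `P`. Solutions for
`P` and for `P'` live on different reduced tori; they are compared through their preimages in the
torus `(ℂˣ)^{exponents f}`. In the order on `Finpartition`, `P' < P` says that `P'` is a proper
refinement of `P`. -/
def maximalSolutions (P : AdmissiblePartition f) (c : BaseChoice P) : Set (ReducedTorus P c) :=
  {x | x ∈ solutions P c ∧ ∀ P' : AdmissiblePartition f, P'.1 < P.1 →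
    ∀ y : BigTorus f, beta P c y = x → y ∉ homogeneousSolutions P'}

/-- `S(P, f)`: the maximal solutions of finite order. -/
def torsionSolutions (P : AdmissiblePartition f) (c : BaseChoice P) : Set (ReducedTorus P c) :=
  {x | x ∈ maximalSolutions P c ∧ IsOfFinOrder x}

open Classical in
/-- `1` if some point of the torus is mapped by `psi` into `S(P, f)`, and `0` otherwise. -/
def delta (P : AdmissiblePartition f) (c : BaseChoice P) : ℕ :=
  if ∃ x : Torus r, psi P c x ∈ torsionSolutions P c then 1 else 0

/-- The least common multiple of the orders of the elements of `S(P, f)`; it is `1` if `S(P, f)`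
is empty. -/
def orderLcm (P : AdmissiblePartition f) (c : BaseChoice P) : ℕ :=
  sInf {m : ℕ | 0 < m ∧ ∀ x ∈ torsionSolutions P c, orderOf x ∣ m}

/-- `M(f)`. -/
def totalOrderLcm (f : Laurent r) (c : ∀ P : AdmissiblePartition f, BaseChoice P) : ℕ :=
  (Finset.univ : Finset (AdmissiblePartition f)).lcm fun P => orderLcm P (c P)

/-- `D(f)`. -/
def totalMaxOrder (f : Laurent r) : ℕ :=
  (Finset.univ : Finset (Finset (AdmissiblePartition f))).lcm fun U =>
    maxOrderSatQuot (differenceGroupOfSet U)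

end Partitions

/-! ### Polynomial periodic functions -/

/-- The number of points `x` of `A` with `x^n = 1` (used for `n ≥ 1`). -/
def torsionCount {r : ℕ} (A : Set (Torus r)) (n : ℕ) : ℕ :=
  Nat.card {x : Torus r // x ∈ A ∧ x ^ n = 1}

/-- `p(n) = ∑ a_i(n) n^i` for all `n ≥ 1`, with finitely many nonzero periodic functions `a_i`. -/
def IsPolynomialPeriodicExpansion (p : ℕ → ℕ) (a : ℕ →₀ (ℕ → ℂ)) : Prop :=
  (∀ i, ∃ c : ℕ, 0 < c ∧ Function.Periodic (a i) c) ∧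
    ∀ n : ℕ, 1 ≤ n → (p n : ℂ) = ∑ i ∈ a.support, a i n * (n : ℂ) ^ i

/-- The largest `i` with `a_i` not identically zero (`0` if there is none). -/
def expansionDegree (a : ℕ →₀ (ℕ → ℂ)) : ℕ := a.support.sup id

/-- The least positive period of a periodic function. -/
def leastPeriod (g : ℕ → ℂ) : ℕ := sInf {c : ℕ | 0 < c ∧ Function.Periodic g c}

/-- The least common multiple of the periods of the `a_i` (the zero function has period `1`). -/
def expansionPeriod (a : ℕ →₀ (ℕ → ℂ)) : ℕ := a.support.lcm fun i => leastPeriod (a i)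

end TorusTorsion

end

open TorusTorsion

noncomputable section

/-- A finite-level version of `x ∈ ℚ(ζ_N)`. -/
theorem exists_level_of_mem_adjoin_rootsOfUnity {x : ℂ}
    (hx : x ∈ Algebra.adjoin ℚ {z : ℂ | ∃ n : ℕ, 0 < n ∧ z ^ n = 1}) :
    ∃ N : ℕ, 0 < N ∧ ∀ M : ℕ, N ∣ M → 0 < M → ∀ ζ : ℂ, IsPrimitiveRoot ζ M →
      x ∈ Algebra.adjoin ℚ {ζ} := by
  induction hx using Algebra.adjoin_induction with
  | mem z hz =>
    obtain ⟨n, hn, hz⟩ := hz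
    refine ⟨n, hn, fun M hM hM0 ζ hζ => ?_⟩
    have : NeZero M := ⟨hM0.ne'⟩
    obtain ⟨k, rfl⟩ := hM
    obtain ⟨i, -, rfl⟩ := hζ.eq_pow_of_pow_eq_one (show z ^ (n * k) = 1 by rw [pow_mul, hz, one_pow])
    exact pow_mem (Algebra.self_mem_adjoin_singleton ℚ ζ) i
  | algebraMap q => exact ⟨1, one_pos, fun _ _ _ _ _ => Subalgebra.algebraMap_mem _ q⟩
  | add a b _ _ ha hb =>
    obtain ⟨N, hN, ha⟩ := ha
    obtain ⟨N', hN', hb⟩ := hb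
    exact ⟨N * N', Nat.mul_pos hN hN', fun M hM h0 ζ hζ =>
      add_mem (ha M (dvd_of_mul_right_dvd hM) h0 ζ hζ) (hb M (dvd_of_mul_left_dvd hM) h0 ζ hζ)⟩
  | mul a b _ _ ha hb =>
    obtain ⟨N, hN, ha⟩ := ha
    obtain ⟨N', hN', hb⟩ := hb
    exact ⟨N * N', Nat.mul_pos hN hN', fun M hM h0 ζ hζ =>
      mul_mem (ha M (dvd_of_mul_right_dvd hM) h0 ζ hζ) (hb M (dvd_of_mul_left_dvd hM) h0 ζ hζ)⟩

/-- The maximal cyclotomic extension of `ℚ` inside `ℂ`. -/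
def cyclotomicClosure : IntermediateField ℚ ℂ :=
  IntermediateField.adjoin ℚ {z : ℂ | ∃ n : ℕ, 0 < n ∧ z ^ n = 1}

theorem mem_adjoin_of_mem_cyclotomicClosure {x : ℂ} (hx : x ∈ cyclotomicClosure) :
    x ∈ Algebra.adjoin ℚ {z : ℂ | ∃ n : ℕ, 0 < n ∧ z ^ n = 1} := by
  have h := IntermediateField.adjoin_toSubalgebra_of_isAlgebraic (F := ℚ) (E := ℂ)
    (S := {z : ℂ | ∃ n : ℕ, 0 < n ∧ z ^ n = 1}) (by
      rintro z ⟨n, hn, hz⟩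
      refine (IsIntegral.of_pow hn (?_ : IsIntegral ℚ (z ^ n))).isAlgebraic
      rw [hz]
      exact isIntegral_one)
  rw [← h]
  exact hx

theorem mem_cyclotomicClosure_of_pow_eq_one {z : ℂ} {n : ℕ} (hn : 0 < n) (hz : z ^ n = 1) :
    z ∈ cyclotomicClosure :=
  IntermediateField.subset_adjoin _ _ ⟨n, hn, hz⟩

open Polynomial in
/-- Conjugating a linear relation between roots of unity with coefficients in `ℚ(ζ_N)`. -/
theorem sum_mul_pow_eq_zero_of_mem_adjoin {ι : Type*} [Fintype ι] {N M u : ℕ} {ζ : ℂ}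
    (hζ : IsPrimitiveRoot ζ M) (hM : 0 < M) (hNM : N ∣ M) {c : ι → ℂ}
    (hc : ∀ i, c i ∈ Algebra.adjoin ℚ {ζ ^ (M / N)}) {y : ι → ℂ} (hy : ∀ i, y i ^ M = 1)
    (h0 : ∑ i, c i * y i = 0) (hu : u.Coprime M) (huN : u ≡ 1 [MOD N]) :
    ∑ i, c i * y i ^ u = 0 := by
  have : NeZero M := ⟨hM.ne'⟩
  have hN : 0 < N := Nat.pos_of_dvd_of_pos hNM hM
  simp only [Algebra.adjoin_singleton_eq_range_aeval, AlgHom.mem_range] at hc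
  choose g hg using hc
  have hy' : ∀ i, ∃ e : ℕ, ζ ^ e = y i := fun i => by
    obtain ⟨e, -, he⟩ := hζ.eq_pow_of_pow_eq_one (hy i)
    exact ⟨e, he⟩
  choose e he using hy'
  set G : ℚ[X] := ∑ i, (g i).comp (X ^ (M / N)) * X ^ e i with hG
  have hev : ∀ w : ℂ, aeval w G = ∑ i, aeval (w ^ (M / N)) (g i) * w ^ e i := by
    intro w
    simp [hG, map_sum, aeval_comp]
  have h1 : aeval ζ G = 0 := by
    rw [hev, ← h0]
    exact Finset.sum_congr rfl fun i _ => by rw [hg, he]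
  have h2 : cyclotomic M ℚ ∣ G := by
    rw [cyclotomic_eq_minpoly_rat hζ hM]
    exact minpoly.dvd _ _ h1
  have h3 : aeval (ζ ^ u) G = 0 := by
    refine aeval_eq_zero_of_dvd_aeval_eq_zero h2 ?_
    rw [cyclotomic_eq_minpoly_rat (hζ.pow_of_coprime u hu) hM]
    exact minpoly.aeval _ _
  have h4 : (ζ ^ u) ^ (M / N) = ζ ^ (M / N) := by
    have hprim : IsPrimitiveRoot (ζ ^ (M / N)) N :=
      hζ.pow hM (Nat.div_mul_cancel hNM).symm
    rw [← pow_mul, mul_comm, pow_mul]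
    conv_rhs => rw [← pow_one (ζ ^ (M / N))]
    exact pow_eq_pow_of_modEq huN hprim.pow_eq_one
  rw [hev, h4] at h3
  rw [← h3]
  refine Finset.sum_congr rfl fun i _ => ?_
  rw [hg, ← he, ← pow_mul, ← pow_mul, mul_comm u]

/-- Linear relations between roots of unity are preserved by `y ↦ y ^ u` when `u ≡ 1` modulo a
constant depending only on the coefficients. -/
theorem exists_modulus_sum_mul_pow_eq_zero {ι : Type*} [Fintype ι] (a : ι → ℂ) :
    ∃ N : ℕ, 0 < N ∧ ∀ M : ℕ, N ∣ M → 0 < M → ∀ y : ι → ℂ, (∀ i, y i ^ M = 1) →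
      ∑ i, a i * y i = 0 → ∀ u : ℕ, u.Coprime M → u ≡ 1 [MOD N] → ∑ i, a i * y i ^ u = 0 := by
  classical
  let b := Module.Basis.ofVectorSpace cyclotomicClosure ℂ
  have key : ∀ x : cyclotomicClosure, ∃ N : ℕ, 0 < N ∧ ∀ M : ℕ, N ∣ M → 0 < M → ∀ ζ : ℂ,
      IsPrimitiveRoot ζ M → (x : ℂ) ∈ Algebra.adjoin ℚ {ζ} := fun x =>
    exists_level_of_mem_adjoin_rootsOfUnity (mem_adjoin_of_mem_cyclotomicClosure x.2)
  choose lev hlev0 hlev using key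
  let N : ℕ := ∏ i, ∏ j ∈ (b.repr (a i)).support, lev (b.repr (a i) j)
  have hN : 0 < N := Finset.prod_pos fun i _ => Finset.prod_pos fun j _ => hlev0 _
  have hNζ : ∀ ζ : ℂ, IsPrimitiveRoot ζ N → ∀ i j,
      ((b.repr (a i) j : cyclotomicClosure) : ℂ) ∈ Algebra.adjoin ℚ {ζ} := by
    intro ζ hζ i j
    by_cases hj : j ∈ (b.repr (a i)).support
    · refine hlev _ N ?_ hN ζ hζ
      exact (Finset.dvd_prod_of_mem (fun j => lev (b.repr (a i) j)) hj).trans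
        (Finset.dvd_prod_of_mem (fun i => ∏ j ∈ (b.repr (a i)).support, lev (b.repr (a i) j))
          (Finset.mem_univ i))
    · rw [Finsupp.notMem_support_iff.1 hj]
      exact zero_mem _
  have coords : ∀ y : ι → cyclotomicClosure, ∑ i, a i * (y i : ℂ) = 0 ↔
      ∀ j, ∑ i, ((b.repr (a i) j : cyclotomicClosure) : ℂ) * (y i : ℂ) = 0 := by
    intro y
    have h1 : ∑ i, a i * (y i : ℂ) = ∑ i, y i • a i :=
      Finset.sum_congr rfl fun i _ => by rw [mul_comm]; rfl
    rw [h1, ← b.repr.map_eq_zero_iff, map_sum, Finsupp.ext_iff]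
    refine forall_congr' fun j => ?_
    rw [Finsupp.finsetSum_apply, Finsupp.zero_apply, ← map_eq_zero_iff cyclotomicClosure.val
      cyclotomicClosure.val.injective, map_sum]
    refine Eq.congr (Finset.sum_congr rfl fun i _ => ?_) rfl
    rw [map_smul, Finsupp.smul_apply, smul_eq_mul, map_mul, mul_comm]
    rfl
  refine ⟨N, hN, fun M hNM hM y hy h0 u hu huN => ?_⟩
  have hζ := Complex.isPrimitiveRoot_exp M hM.ne'
  have hyF : ∀ i, y i ∈ cyclotomicClosure := fun i => mem_cyclotomicClosure_of_pow_eq_one hM (hy i)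
  have e1 := (coords fun i => ⟨y i, hyF i⟩).1 h0
  refine (coords fun i => ⟨y i ^ u, pow_mem (hyF i) u⟩).2 fun j => ?_
  exact sum_mul_pow_eq_zero_of_mem_adjoin hζ hM hNM
    (fun i => hNζ _ (hζ.pow hM (Nat.div_mul_cancel hNM).symm) i j) hy (e1 j) hu huN

/-- If all power sums `∑ b_i ω_i ^ t` vanish, so does the sum of the `b_i` with `ω_i = 1`. -/
theorem sum_filter_eq_one_eq_zero {ι : Type*} [Fintype ι] {b ω : ι → ℂ}
    (h : ∀ t : ℕ, ∑ i, b i * ω i ^ t = 0) : ∑ i with ω i = 1, b i = 0 := by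
  classical
  have hpoly : ∀ g : Polynomial ℂ, ∑ i, b i * g.eval (ω i) = 0 := by
    intro g
    simp_rw [Polynomial.eval_eq_sum_range, Finset.mul_sum]
    rw [Finset.sum_comm]
    refine Finset.sum_eq_zero fun t _ => ?_
    rw [← mul_zero (g.coeff t), ← h t, Finset.mul_sum]
    exact Finset.sum_congr rfl fun i _ => by ring
  set s : Finset ℂ := (Finset.univ.image ω).erase 1 with hs
  have h1 := hpoly (∏ w ∈ s, (Polynomial.X - Polynomial.C w))
  simp only [Polynomial.eval_prod, Polynomial.eval_sub, Polynomial.eval_X, Polynomial.eval_C] at h1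
  have h2 : ∑ i with ω i = 1, b i * ∏ w ∈ s, (ω i - w) = 0 := by
    rw [← h1, Finset.sum_filter]
    refine Finset.sum_congr rfl fun i _ => ?_
    split_ifs with hi
    · rfl
    · rw [Finset.prod_eq_zero (i := ω i), mul_zero]
      · simp [hs, hi]
      · simp
  have h3 : ∏ w ∈ s, ((1 : ℂ) - w) ≠ 0 :=
    Finset.prod_ne_zero_iff.2 fun w hw => sub_ne_zero.2 (Finset.ne_of_mem_erase hw).symm
  have h4 : (∑ i with ω i = 1, b i) * ∏ w ∈ s, ((1 : ℂ) - w) = 0 := by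
    rw [← h2, Finset.sum_mul]
    exact Finset.sum_congr rfl fun i hi => by rw [(Finset.mem_filter.1 hi).2]
  exact (mul_eq_zero.1 h4).resolve_right h3

/-- If the power sums `∑ b_i ω_i ^ t` of fewer than `p` many `p`-th roots of unity vanish for all
exponents `t` outside a single residue class modulo `p`, they all vanish. -/
theorem power_sum_eq_zero_of_card_lt {ι : Type*} [Fintype ι] {p : ℕ} (hp : 0 < p)
    (hcard : Fintype.card ι < p) {b ω : ι → ℂ} (hω : ∀ i, ω i ^ p = 1) (t : ℕ)
    (h : ∀ s : ℕ, 0 < s → s < p → ∑ i, b i * ω i ^ (t + s) = 0) : ∑ i, b i * ω i ^ t = 0 := by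
  classical
  have hprim := Complex.isPrimitiveRoot_exp p hp.ne'
  obtain ⟨w, hw, hwω⟩ : ∃ w ∈ Polynomial.nthRootsFinset p (1 : ℂ), w ∉ Finset.univ.image ω := by
    refine Finset.exists_mem_notMem_of_card_lt_card ?_
    rw [hprim.card_nthRootsFinset]
    exact Finset.card_image_le.trans_lt hcard
  rw [Polynomial.mem_nthRootsFinset hp] at hw
  have hw0 : w ≠ 0 := by
    rintro rfl
    rw [zero_pow hp.ne'] at hw
    exact zero_ne_one hw
  have hgeom : ∀ i, ∑ s ∈ Finset.range p, (ω i / w) ^ s = 0 := by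
    intro i
    have h1 : ω i / w - 1 ≠ 0 := by
      intro h1
      rw [sub_eq_zero, div_eq_one_iff_eq hw0] at h1
      exact hwω (Finset.mem_image.2 ⟨i, Finset.mem_univ i, h1⟩)
    have h2 := geom_sum_mul (ω i / w) p
    rw [div_pow, hω, hw, div_one, sub_self] at h2
    exact (mul_eq_zero.1 h2).resolve_right h1
  have h0 : ∑ s ∈ Finset.range p, (∑ i, b i * ω i ^ (t + s)) / w ^ s = 0 := by
    simp_rw [Finset.sum_div]
    rw [Finset.sum_comm]
    refine Finset.sum_eq_zero fun i _ => ?_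
    rw [← mul_zero (b i * ω i ^ t), ← hgeom i, Finset.mul_sum]
    refine Finset.sum_congr rfl fun s _ => ?_
    rw [div_pow, pow_add]
    ring
  rw [Finset.sum_eq_single 0] at h0
  · simpa using h0
  · intro s hs hs0
    rw [h s (Nat.pos_of_ne_zero hs0) (Finset.mem_range.1 hs), zero_div]
  · intro h
    exact absurd (Finset.mem_range.2 hp) h

/-- **Mann's theorem** over `ℂ`: the orders of the nondegenerate solutions in roots of unity of a
linear equation, normalized at one coordinate, are bounded. -/
theorem exists_pow_eq_one_of_nondegenerate {ι : Type*} [Fintype ι] (a : ι → ℂ) (i₀ : ι) :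
    ∃ R : ℕ, 0 < R ∧ ∀ y : ι → ℂ, (∀ i, IsOfFinOrder (y i)) → y i₀ = 1 →
      ∑ i, a i * y i = 0 →
      (∀ I : Finset ι, I.Nonempty → I ≠ Finset.univ → ∑ i ∈ I, a i * y i ≠ 0) →
      ∀ i, y i ^ R = 1 := by
  classical
  obtain ⟨N, hN, hconj⟩ := exists_modulus_sum_mul_pow_eq_zero a
  refine ⟨N * primorial (Fintype.card ι), Nat.mul_pos hN (primorial_pos _), ?_⟩
  intro y hfin hy0 hsum hnd
  have hex : ∃ k : ℕ, 0 < k ∧ ∀ i, y i ^ (N * k) = 1 := by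
    refine ⟨∏ i, orderOf (y i), Finset.prod_pos fun i _ => (hfin i).orderOf_pos, fun i => ?_⟩
    refine orderOf_dvd_iff_pow_eq_one.1 ?_
    exact (Finset.dvd_prod_of_mem (fun i => orderOf (y i)) (Finset.mem_univ i)).trans
      (dvd_mul_left _ _)
  set k := Nat.find hex with hk
  obtain ⟨hk0, hky⟩ := Nat.find_spec hex
  rw [← hk] at hk0 hky
  have step : ∀ p k' : ℕ, p.Prime → k = p * k' → (p ∣ N * k' ∨ Fintype.card ι < p) → False := by
    intro p k' hp hpk hcase
    have hk'0 : 0 < k' := Nat.pos_of_ne_zero fun h => by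
      rw [h, mul_zero] at hpk
      exact hk0.ne' hpk
    have hM : N * k = p * (N * k') := by rw [hpk]; ring
    have hωp : ∀ i, (y i ^ (N * k')) ^ p = 1 := fun i => by
      rw [← pow_mul, mul_comm, ← hM, hky]
    have key : ∀ t : ℕ, ¬ p ∣ 1 + t * (N * k') →
        ∑ i, a i * y i * (y i ^ (N * k')) ^ t = 0 := by
      intro t ht
      have hcop : (1 + t * (N * k')).Coprime (N * k) := by
        rw [hM]
        refine Nat.Coprime.mul_right ((hp.coprime_iff_not_dvd.2 ht).symm) ?_
        simp
      have hmod : 1 + t * (N * k') ≡ 1 [MOD N] := by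
        have : 1 + t * (N * k') = 1 + N * (t * k') := by ring
        rw [this]
        simp [Nat.ModEq]
      rw [← hconj (N * k) (dvd_mul_right _ _) (Nat.mul_pos hN hk0) y hky hsum _ hcop hmod]
      refine Finset.sum_congr rfl fun i _ => ?_
      rw [pow_add, pow_one, mul_comm t, pow_mul]
      ring
    have hall : ∀ t : ℕ, ∑ i, a i * y i * (y i ^ (N * k')) ^ t = 0 := by
      intro t
      by_cases ht : p ∣ 1 + t * (N * k')
      · have hpn : ¬ p ∣ N * k' := fun h =>
          hp.one_lt.ne' (Nat.dvd_one.1 ((Nat.dvd_add_left (h.mul_left t)).1 ht))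
        refine power_sum_eq_zero_of_card_lt hp.pos (hcase.resolve_left hpn) hωp t fun s hs hsp => ?_
        refine key _ fun hd => ?_
        have : 1 + (t + s) * (N * k') = (1 + t * (N * k')) + s * (N * k') := by ring
        rw [this, Nat.dvd_add_right ht] at hd
        rcases hp.dvd_mul.1 hd with h | h
        · exact absurd (Nat.le_of_dvd hs h) (not_le.2 hsp)
        · exact hpn h
      · exact key t ht
    have hI := sum_filter_eq_one_eq_zero hall
    have huniv : Finset.univ.filter (fun i => y i ^ (N * k') = 1) = Finset.univ := by
      by_contra hne
      exact hnd _ ⟨i₀, by simp [hy0]⟩ hne hI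
    have hmin := Nat.find_min' hex (m := k') ⟨hk'0, fun i => by
      have := Finset.mem_univ i
      rw [← huniv] at this
      exact (Finset.mem_filter.1 this).2⟩
    rw [← hk, hpk] at hmin
    nlinarith [hp.two_le]
  have hsq : Squarefree k := by
    rw [Nat.squarefree_iff_prime_squarefree]
    rintro p hp ⟨m, hm⟩
    exact step p (p * m) hp (by rw [hm]; ring) (Or.inl ⟨N * m, by ring⟩)
  have hdvd : k ∣ primorial (Fintype.card ι) := by
    rw [← Nat.prod_primeFactors_of_squarefree hsq, primorial]
    refine Finset.prod_dvd_prod_of_subset _ _ _ fun p hp => ?_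
    rw [Nat.mem_primeFactors] at hp
    obtain ⟨hp, ⟨k', hk'⟩, -⟩ := hp
    rw [Finset.mem_filter, Finset.mem_range]
    refine ⟨?_, hp⟩
    by_contra hlt
    exact step p k' hp hk' (Or.inr (by omega))
  intro i
  obtain ⟨m, hm⟩ := hdvd
  rw [hm, ← mul_assoc, pow_mul, hky, one_pow]

section Monomials

variable {r : ℕ}

@[simp] theorem monomialValue_zero (x : Torus r) : monomialValue x 0 = 1 := by
  simp [monomialValue]

theorem monomialValue_add (x : Torus r) (l m : Fin r → ℤ) :
    monomialValue x (l + m) = monomialValue x l * monomialValue x m := by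
  simp [monomialValue, zpow_add, Finset.prod_mul_distrib]

theorem monomialValue_neg (x : Torus r) (l : Fin r → ℤ) :
    monomialValue x (-l) = (monomialValue x l)⁻¹ := by
  simp [monomialValue]

theorem monomialValue_sub (x : Torus r) (l m : Fin r → ℤ) :
    monomialValue x (l - m) = monomialValue x l / monomialValue x m := by
  rw [sub_eq_add_neg, monomialValue_add, monomialValue_neg, div_eq_mul_inv]

theorem monomialValue_nsmul (x : Torus r) (n : ℕ) (l : Fin r → ℤ) :
    monomialValue x (n • l) = monomialValue x l ^ n := by
  induction n with
  | zero => simp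
  | succ n ih => rw [succ_nsmul, monomialValue_add, ih, pow_succ]

theorem monomialValue_mul (x y : Torus r) (l : Fin r → ℤ) :
    monomialValue (x * y) l = monomialValue x l * monomialValue y l := by
  simp [monomialValue, mul_zpow, Finset.prod_mul_distrib]

@[simp] theorem monomialValue_one (l : Fin r → ℤ) : monomialValue (1 : Torus r) l = 1 := by
  simp [monomialValue]

theorem monomialValue_inv (x : Torus r) (l : Fin r → ℤ) :
    monomialValue x⁻¹ l = (monomialValue x l)⁻¹ := by
  simp [monomialValue]

theorem monomialValue_div (x y : Torus r) (l : Fin r → ℤ) :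
    monomialValue (x / y) l = monomialValue x l / monomialValue y l := by
  rw [div_eq_mul_inv, monomialValue_mul, monomialValue_inv, div_eq_mul_inv]

theorem monomialValue_pow (x : Torus r) (n : ℕ) (l : Fin r → ℤ) :
    monomialValue (x ^ n) l = monomialValue x l ^ n := by
  induction n with
  | zero => simp
  | succ n ih => rw [pow_succ, monomialValue_mul, ih, pow_succ]

theorem continuous_monomialValue (l : Fin r → ℤ) :
    Continuous fun x : Torus r => monomialValue x l :=
  continuous_finsetProd _ fun i _ => (continuous_apply i).zpow (l i)

/-- Two points agreeing on the monomials in a set agree on those in the subgroup it generates. -/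
theorem monomialValue_eq_of_mem_closure {x y : Torus r} {S : Set (Fin r → ℤ)}
    (h : ∀ l ∈ S, monomialValue x l = monomialValue y l) {l : Fin r → ℤ}
    (hl : l ∈ AddSubgroup.closure S) : monomialValue x l = monomialValue y l := by
  induction hl using AddSubgroup.closure_induction with
  | mem l hl => exact h l hl
  | zero => simp
  | add a b _ _ ha hb => rw [monomialValue_add, monomialValue_add, ha, hb]
  | neg a _ ha => rw [monomialValue_neg, monomialValue_neg, ha]

end Monomials

section Coordinates

variable {r : ℕ} (b : Module.Basis (Fin r) ℤ (Fin r → ℤ))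

/-- The point of the torus with prescribed values at the monomials of a basis of `ℤ^r`. -/
def torusOfCoords (X : Fin r → ℂˣ) : Torus r :=
  fun i => ∏ j, X j ^ b.repr (Pi.single i 1) j

theorem zpow_finsetSum {ι G : Type*} [CommGroup G] (s : Finset ι) (x : G) (n : ι → ℤ) :
    x ^ ∑ i ∈ s, n i = ∏ i ∈ s, x ^ n i := by
  classical
  induction s using Finset.induction_on with
  | empty => simp
  | insert i s hi ih => rw [Finset.sum_insert hi, Finset.prod_insert hi, zpow_add, ih]

theorem monomialValue_torusOfCoords (X : Fin r → ℂˣ) (l : Fin r → ℤ) :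
    monomialValue (torusOfCoords b X) l = ∏ j, X j ^ b.repr l j := by
  have h : ∀ j, b.repr l j = ∑ i, l i * b.repr (Pi.single i 1) j := by
    intro j
    conv_lhs => rw [pi_eq_sum_univ' l]
    rw [map_sum, Finsupp.finsetSum_apply]
    refine Finset.sum_congr rfl fun i _ => ?_
    rw [map_smul, Finsupp.smul_apply, smul_eq_mul]
  simp only [monomialValue, torusOfCoords, ← Finset.prod_zpow, ← zpow_mul]
  rw [Finset.prod_comm]
  refine Finset.prod_congr rfl fun j _ => ?_
  rw [h, zpow_finsetSum]
  exact Finset.prod_congr rfl fun i _ => by rw [mul_comm]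

theorem monomialValue_torusOfCoords_basis (X : Fin r → ℂˣ) (j : Fin r) :
    monomialValue (torusOfCoords b X) (b j) = X j := by
  rw [monomialValue_torusOfCoords, Finset.prod_eq_single j]
  · simp
  · intro i _ hi
    simp [hi.symm]
  · simp

theorem monomialValue_single (x : Torus r) (i : Fin r) :
    monomialValue x (Pi.single i 1) = x i := by
  rw [monomialValue, Finset.prod_eq_single i]
  · simp
  · intro j _ hj
    simp [hj]
  · simp

theorem torusOfCoords_monomialValue (x : Torus r) :
    torusOfCoords b (fun j => monomialValue x (b j)) = x := by
  have h : ∀ l ∈ AddSubgroup.closure (Set.range b),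
      monomialValue (torusOfCoords b (fun j => monomialValue x (b j))) l = monomialValue x l := by
    refine fun l hl => monomialValue_eq_of_mem_closure ?_ hl
    rintro _ ⟨j, rfl⟩
    rw [monomialValue_torusOfCoords_basis]
  refine funext fun i => ?_
  rw [← monomialValue_single (torusOfCoords b _) i, ← monomialValue_single x i, h]
  have hs := b.mem_span (Pi.single i 1)
  rwa [← Submodule.mem_toAddSubgroup, Submodule.span_int_eq_addSubgroupClosure] at hs

/-- A basis of `ℤ^r` identifies the torus with itself through the values at the basis monomials. -/
def coordEquiv : Torus r ≃ (Fin r → ℂˣ) where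
  toFun x j := monomialValue x (b j)
  invFun := torusOfCoords b
  left_inv := torusOfCoords_monomialValue b
  right_inv X := funext fun j => monomialValue_torusOfCoords_basis b X j

theorem monomialValue_eq_prod (x : Torus r) (l : Fin r → ℤ) :
    monomialValue x l = ∏ j, monomialValue x (b j) ^ b.repr l j := by
  conv_lhs => rw [← torusOfCoords_monomialValue b x]
  rw [monomialValue_torusOfCoords]

end Coordinates

section Smith

variable {r : ℕ}

/-- The Smith normal form of a subgroup of `ℤ^r`: it is described by divisibility conditions on
the coordinates in a suitable basis. -/
theorem exists_basis_mem_iff_dvd (E : AddSubgroup (Fin r → ℤ)) :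
    ∃ (b : Module.Basis (Fin r) ℤ (Fin r → ℤ)) (d : Fin r → ℕ),
      ∀ l, l ∈ E ↔ ∀ j, (d j : ℤ) ∣ b.repr l j := by
  classical
  obtain ⟨n, S⟩ := Submodule.smithNormalForm (Pi.basisFun ℤ (Fin r)) (AddSubgroup.toIntSubmodule E)
  let d : Fin r → ℕ := fun j => if h : ∃ i, S.f i = j then (S.a h.choose).natAbs else 0
  have hd : ∀ i, d (S.f i) = (S.a i).natAbs := by
    intro i
    have h : ∃ i', S.f i' = S.f i := ⟨i, rfl⟩
    have h2 : h.choose = i := S.f.injective h.choose_spec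
    simp only [d, dif_pos h, h2]
  have hd0 : ∀ j, j ∉ Set.range S.f → d j = 0 := fun j hj => dif_neg hj
  refine ⟨S.bM, d, fun l => ⟨fun hl j => ?_, fun h => ?_⟩⟩
  · let m : AddSubgroup.toIntSubmodule E := ⟨l, hl⟩
    by_cases hj : j ∈ Set.range S.f
    · obtain ⟨i, rfl⟩ := hj
      have h1 := S.repr_apply_embedding_eq_repr_smul (m := m) (i := i)
      rw [hd, Int.natAbs_dvd]
      change S.a i ∣ S.bM.repr (m : Fin r → ℤ) (S.f i)
      rw [h1, map_smul, Finsupp.smul_apply, smul_eq_mul]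
      exact dvd_mul_right _ _
    · have h1 := S.repr_eq_zero_of_notMem_range m hj
      change (d j : ℤ) ∣ S.bM.repr (m : Fin r → ℤ) j
      rw [h1]
      exact dvd_zero _
  · rw [← S.bM.sum_repr l]
    refine E.sum_mem fun j _ => ?_
    by_cases hj : j ∈ Set.range S.f
    · obtain ⟨i, rfl⟩ := hj
      have h1 := h (S.f i)
      rw [hd, Int.natAbs_dvd] at h1
      obtain ⟨q, hq⟩ := h1
      rw [hq, mul_comm, mul_smul, ← S.snf i]
      exact E.zsmul_mem (S.bN i).2 q
    · have h1 := h j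
      rw [hd0 j hj, Int.natCast_zero, zero_dvd_iff] at h1
      rw [h1, zero_smul]
      exact E.zero_mem

variable {E : AddSubgroup (Fin r → ℤ)} {b : Module.Basis (Fin r) ℤ (Fin r → ℤ)} {d : Fin r → ℕ}

theorem mem_saturation_iff_repr (h : ∀ l, l ∈ E ↔ ∀ j, (d j : ℤ) ∣ b.repr l j)
    (l : Fin r → ℤ) : l ∈ saturation E ↔ ∀ j, d j = 0 → b.repr l j = 0 := by
  constructor
  · rintro ⟨n, hn, hl⟩ j hj
    have h1 := (h _).1 hl j
    rw [hj, Int.natCast_zero, zero_dvd_iff, map_nsmul, Finsupp.smul_apply, smul_eq_zero] at h1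
    exact h1.resolve_left hn.ne'
  · intro hl
    refine ⟨∏ j with d j ≠ 0, d j, Finset.prod_pos fun j hj =>
      Nat.pos_of_ne_zero (Finset.mem_filter.1 hj).2, (h _).2 fun j => ?_⟩
    rw [map_nsmul, Finsupp.smul_apply, nsmul_eq_mul]
    by_cases hj : d j = 0
    · rw [hl j hj, mul_zero]
      exact dvd_zero _
    · exact (Int.natCast_dvd_natCast.2
        (Finset.dvd_prod_of_mem d (Finset.mem_filter.2 ⟨Finset.mem_univ j, hj⟩))).mul_right _

theorem prod_nsmul_mem_of_mem_saturation (h : ∀ l, l ∈ E ↔ ∀ j, (d j : ℤ) ∣ b.repr l j)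
    {l : Fin r → ℤ} (hl : l ∈ saturation E) : (∏ j with d j ≠ 0, d j) • l ∈ E := by
  refine (h _).2 fun j => ?_
  rw [map_nsmul, Finsupp.smul_apply, nsmul_eq_mul]
  by_cases hj : d j = 0
  · rw [(mem_saturation_iff_repr h l).1 hl j hj, mul_zero]
    exact dvd_zero _
  · exact (Int.natCast_dvd_natCast.2
      (Finset.dvd_prod_of_mem d (Finset.mem_filter.2 ⟨Finset.mem_univ j, hj⟩))).mul_right _

theorem exists_pos_nsmul_mem (E : AddSubgroup (Fin r → ℤ)) :
    ∃ K : ℕ, 0 < K ∧ ∀ l ∈ saturation E, K • l ∈ E := by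
  obtain ⟨b, d, h⟩ := exists_basis_mem_iff_dvd E
  exact ⟨_, Finset.prod_pos fun j hj => Nat.pos_of_ne_zero (Finset.mem_filter.1 hj).2,
    fun l hl => prod_nsmul_mem_of_mem_saturation h hl⟩

theorem nsmul_quotient_eq_zero_iff (E : AddSubgroup (Fin r → ℤ)) (K : ℕ)
    (l : saturation E) :
    K • (QuotientAddGroup.mk l : saturation E ⧸ E.addSubgroupOf (saturation E)) = 0 ↔
      K • (l : Fin r → ℤ) ∈ E := by
  rw [← QuotientAddGroup.mk_nsmul, QuotientAddGroup.eq_zero_iff, AddSubgroup.mem_addSubgroupOf]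
  rfl

theorem maxOrderSatQuot_eq_exponent (E : AddSubgroup (Fin r → ℤ)) :
    maxOrderSatQuot E = AddMonoid.exponent (saturation E ⧸ E.addSubgroupOf (saturation E)) ∧
      0 < maxOrderSatQuot E := by
  obtain ⟨K, hK, hKE⟩ := exists_pos_nsmul_mem E
  have hzero : ∀ g : saturation E ⧸ E.addSubgroupOf (saturation E), K • g = 0 := by
    intro g
    induction g using QuotientAddGroup.induction_on with
    | H l => exact (nsmul_quotient_eq_zero_iff E K l).2 (hKE l l.2)
  have h1 : maxOrderSatQuot E =
      AddMonoid.exponent (saturation E ⧸ E.addSubgroupOf (saturation E)) := by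
    rw [maxOrderSatQuot, AddMonoid.exponent_eq_iSup_addOrderOf]
    intro g
    exact Nat.pos_of_dvd_of_pos (addOrderOf_dvd_of_nsmul_eq_zero (hzero g)) hK
  refine ⟨h1, ?_⟩
  rw [h1]
  exact Nat.pos_of_dvd_of_pos (AddMonoid.exponent_dvd_of_forall_nsmul_eq_zero hzero) hK

theorem maxOrderSatQuot_pos (E : AddSubgroup (Fin r → ℤ)) : 0 < maxOrderSatQuot E :=
  (maxOrderSatQuot_eq_exponent E).2

theorem maxOrderSatQuot_nsmul_mem {E : AddSubgroup (Fin r → ℤ)} {l : Fin r → ℤ}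
    (hl : l ∈ saturation E) : maxOrderSatQuot E • l ∈ E := by
  rw [(maxOrderSatQuot_eq_exponent E).1]
  exact (nsmul_quotient_eq_zero_iff E _ ⟨l, hl⟩).1 (AddMonoid.exponent_nsmul_eq_zero _)

theorem basis_mem_saturation (h : ∀ l, l ∈ E ↔ ∀ j, (d j : ℤ) ∣ b.repr l j) {j : Fin r}
    (hj : d j ≠ 0) : b j ∈ saturation E := by
  refine (mem_saturation_iff_repr h _).2 fun i hi => ?_
  rw [b.repr_self, Finsupp.single_apply, if_neg]
  rintro rfl
  exact hj hi

theorem dvd_of_nsmul_basis_mem (h : ∀ l, l ∈ E ↔ ∀ j, (d j : ℤ) ∣ b.repr l j) {j : Fin r}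
    {K : ℕ} : K • b j ∈ E ↔ d j ∣ K := by
  rw [h]
  constructor
  · intro hK
    have := hK j
    rw [map_nsmul, Finsupp.smul_apply, b.repr_self, Finsupp.single_eq_same] at this
    simpa [Int.natCast_dvd_natCast] using this
  · intro hK i
    rw [map_nsmul, b.repr_self, Finsupp.smul_apply, Finsupp.single_apply]
    split_ifs with hij
    · subst hij
      simpa [Int.natCast_dvd_natCast] using hK
    · simp

theorem dvd_maxOrderSatQuot (h : ∀ l, l ∈ E ↔ ∀ j, (d j : ℤ) ∣ b.repr l j) {j : Fin r}
    (hj : d j ≠ 0) : d j ∣ maxOrderSatQuot E :=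
  (dvd_of_nsmul_basis_mem h).1 (maxOrderSatQuot_nsmul_mem (basis_mem_saturation h hj))

theorem rank_saturation_eq_card (h : ∀ l, l ∈ E ↔ ∀ j, (d j : ℤ) ∣ b.repr l j) :
    rank (saturation E) = (Finset.univ.filter fun j => d j ≠ 0).card := by
  classical
  have h1 : AddSubgroup.toIntSubmodule (saturation E) =
      Submodule.span ℤ (Set.range fun j : {j // d j ≠ 0} => b j) := by
    ext l
    have : (Set.range fun j : {j // d j ≠ 0} => b j) = b '' {j | d j ≠ 0} := by
      ext; simp
    rw [this, b.mem_span_image]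
    change l ∈ saturation E ↔ _
    rw [mem_saturation_iff_repr h]
    constructor
    · intro hl j hj hdj
      exact (Finsupp.mem_support_iff.1 hj) (hl j hdj)
    · intro hl j hdj
      by_contra hne
      exact hl (Finsupp.mem_support_iff.2 hne) hdj
  change Module.finrank ℤ (AddSubgroup.toIntSubmodule (saturation E)) = _
  rw [h1, finrank_span_eq_card, Fintype.card_subtype]
  exact b.linearIndependent.comp _ Subtype.val_injective

theorem rank_mono {E F : AddSubgroup (Fin r → ℤ)} (h : E ≤ F) : rank E ≤ rank F :=
  Submodule.finrank_mono (M := Fin r → ℤ) (s := AddSubgroup.toIntSubmodule E)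
    (t := AddSubgroup.toIntSubmodule F) h

theorem saturation_mono {E F : AddSubgroup (Fin r → ℤ)} (h : E ≤ F) :
    saturation E ≤ saturation F := fun _ ⟨n, hn, hl⟩ => ⟨n, hn, h hl⟩

theorem le_saturation (E : AddSubgroup (Fin r → ℤ)) : E ≤ saturation E :=
  fun l hl => ⟨1, one_pos, by rwa [one_smul]⟩

theorem mem_subgroupLocus_iff_coords (h : ∀ l, l ∈ E ↔ ∀ j, (d j : ℤ) ∣ b.repr l j)
    (x : Torus r) : x ∈ subgroupLocus E ↔ ∀ j, monomialValue x (b j) ^ d j = 1 := by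
  constructor
  · intro hx j
    rw [← monomialValue_nsmul]
    exact hx _ ((dvd_of_nsmul_basis_mem h).2 dvd_rfl)
  · intro hx l hl
    rw [monomialValue_eq_prod b]
    refine Finset.prod_eq_one fun j _ => ?_
    obtain ⟨q, hq⟩ := (h l).1 hl j
    rw [hq, zpow_mul, zpow_natCast, hx, one_zpow]

theorem pow_eq_one_iff_coords (b : Module.Basis (Fin r) ℤ (Fin r → ℤ)) (x : Torus r) (n : ℕ) :
    x ^ n = 1 ↔ ∀ j, monomialValue x (b j) ^ n = 1 := by
  constructor
  · intro hx j
    rw [← monomialValue_pow, hx, monomialValue_one]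
  · intro hx
    refine (coordEquiv b).injective (funext fun j => ?_)
    change monomialValue (x ^ n) (b j) = monomialValue 1 (b j)
    rw [monomialValue_pow, hx, monomialValue_one]

theorem card_units_pow_eq_one {n : ℕ} (hn : 0 < n) : Nat.card {u : ℂˣ // u ^ n = 1} = n := by
  have : NeZero n := ⟨hn.ne'⟩
  have h := Complex.card_rootsOfUnity n
  exact (Nat.card_congr (Equiv.subtypeEquivRight fun u => by rw [mem_rootsOfUnity])).trans h

theorem card_subgroupLocus_torsion (h : ∀ l, l ∈ E ↔ ∀ j, (d j : ℤ) ∣ b.repr l j) {n : ℕ}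
    (hn : 0 < n) : Nat.card {x : Torus r // x ∈ subgroupLocus E ∧ x ^ n = 1} =
      ∏ j, (d j).gcd n := by
  have e1 : {x : Torus r // x ∈ subgroupLocus E ∧ x ^ n = 1} ≃
      {X : Fin r → ℂˣ // ∀ j, X j ^ (d j).gcd n = 1} :=
    (coordEquiv b).subtypeEquiv fun x => by
      rw [mem_subgroupLocus_iff_coords h, pow_eq_one_iff_coords b, ← forall_and]
      refine forall_congr' fun j => ?_
      rw [pow_gcd_eq_one]
      rfl
  rw [Nat.card_congr (e1.trans (Equiv.subtypePiEquivPi (p := fun j u => u ^ (d j).gcd n = 1))),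
    Nat.card_pi]
  exact Finset.prod_congr rfl fun j _ => card_units_pow_eq_one (Nat.gcd_pos_of_pos_right _ hn)

/-- The number of `n`-torsion points of `V(E)`. -/
theorem exists_torsion_count_subgroupLocus (E : AddSubgroup (Fin r → ℤ)) :
    ∃ g : ℕ → ℕ, Function.Periodic g (maxOrderSatQuot E) ∧ (∀ n, 0 < g n) ∧
      ∀ n, 0 < n → Nat.card {x : Torus r // x ∈ subgroupLocus E ∧ x ^ n = 1} =
        g n * n ^ (r - rank (saturation E)) := by
  obtain ⟨b, d, h⟩ := exists_basis_mem_iff_dvd E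
  refine ⟨fun n => ∏ j with d j ≠ 0, (d j).gcd n, ?_, ?_, ?_⟩
  · intro n
    refine Finset.prod_congr rfl fun j hj => ?_
    obtain ⟨q, hq⟩ := dvd_maxOrderSatQuot h (Finset.mem_filter.1 hj).2
    rw [hq]
    simp
  · exact fun n => Finset.prod_pos fun j hj =>
      Nat.gcd_pos_of_pos_left _ (Nat.pos_of_ne_zero (Finset.mem_filter.1 hj).2)
  · intro n hn
    rw [card_subgroupLocus_torsion h hn, rank_saturation_eq_card h,
      ← Finset.prod_filter_mul_prod_filter_not Finset.univ (fun j => d j ≠ 0)]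
    congr 1
    have h1 := Finset.card_filter_add_card_filter_not (s := (Finset.univ : Finset (Fin r)))
      (fun j => d j ≠ 0)
    rw [Finset.card_univ, Fintype.card_fin] at h1
    rw [Finset.prod_congr rfl (g := fun _ => n), Finset.prod_const]
    · congr 1
      omega
    · intro j hj
      rw [not_not.1 (Finset.mem_filter.1 hj).2, Nat.gcd_zero_left]

/-- A torsion point can be moved inside its coset of `V(E)` to a point of another exponent, if the
two exponents agree modulo a constant. -/
theorem exists_pow_eq_one_of_modEq {M n n' : ℕ} {x : Torus r}
    (hM : ∀ l ∈ E, monomialValue x l ^ M = 1) (hx : x ^ n = 1)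
    (hn : n ≡ n' [MOD M * maxOrderSatQuot E]) :
    ∃ x' : Torus r, x' ^ n' = 1 ∧ ∀ l ∈ E, monomialValue x' l = monomialValue x l := by
  obtain ⟨b, d, h⟩ := exists_basis_mem_iff_dvd E
  refine ⟨torusOfCoords b fun j => if d j = 0 then 1 else monomialValue x (b j), ?_, ?_⟩
  · rw [pow_eq_one_iff_coords b]
    intro j
    rw [monomialValue_torusOfCoords_basis]
    split_ifs with hj
    · exact one_pow _
    · have h1 : monomialValue x (b j) ^ n = 1 := (pow_eq_one_iff_coords b x n).1 hx j
      have h2 : monomialValue x (b j) ^ (M * maxOrderSatQuot E) = 1 := by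
        rw [mul_comm, pow_mul, ← monomialValue_nsmul]
        exact hM _ (maxOrderSatQuot_nsmul_mem (basis_mem_saturation h hj))
      rw [← h1]
      exact (pow_eq_pow_of_modEq hn h2).symm
  · intro l hl
    rw [monomialValue_torusOfCoords, monomialValue_eq_prod b x l]
    refine Finset.prod_congr rfl fun j _ => ?_
    split_ifs with hj
    · rw [(mem_saturation_iff_repr h l).1 (le_saturation E hl) j hj, zpow_zero, zpow_zero]
    · rfl

end Smith

section Connected

variable {r : ℕ}

theorem isPreconnected_subgroupLocus_saturation (E : AddSubgroup (Fin r → ℤ)) :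
    IsPreconnected (subgroupLocus (saturation E)) := by
  obtain ⟨b, d, h⟩ := exists_basis_mem_iff_dvd E
  have hmem : ∀ X : Fin r → ℂˣ, (∀ j, d j ≠ 0 → X j = 1) →
      torusOfCoords b X ∈ subgroupLocus (saturation E) := by
    intro X hX l hl
    rw [monomialValue_torusOfCoords]
    refine Finset.prod_eq_one fun j _ => ?_
    by_cases hj : d j = 0
    · rw [(mem_saturation_iff_repr h l).1 hl j hj, zpow_zero]
    · rw [hX j hj, one_zpow]
  refine isPreconnected_of_forall 1 fun x hx => ?_
  let γ : ℝ → Torus r := fun s => torusOfCoords b fun j =>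
    Units.mk0 (Complex.exp (s * Complex.log (monomialValue x (b j)))) (Complex.exp_ne_zero _)
  have hγ : Continuous γ := by
    refine continuous_pi fun i => continuous_finsetProd _ fun j _ => Continuous.zpow ?_ _
    rw [Units.continuous_iff]
    constructor
    · change Continuous fun s : ℝ => Complex.exp (s * Complex.log (monomialValue x (b j)))
      fun_prop
    · change Continuous fun s : ℝ => (Units.mk0 (Complex.exp (s * Complex.log
        (monomialValue x (b j)))) (Complex.exp_ne_zero _))⁻¹.val
      simp only [Units.val_inv_eq_inv_val, Units.val_mk0, ← Complex.exp_neg]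
      fun_prop
  refine ⟨γ '' Set.univ, ?_, ⟨0, trivial, ?_⟩, ⟨1, trivial, ?_⟩,
    isPreconnected_univ.image γ hγ.continuousOn⟩
  · rintro _ ⟨s, -, rfl⟩
    refine hmem _ fun j hj => ?_
    rw [hx _ (basis_mem_saturation h hj)]
    ext
    simp
  · funext i
    refine Finset.prod_eq_one fun j _ => ?_
    have h0 : Units.mk0 (Complex.exp ((0 : ℝ) * Complex.log (monomialValue x (b j))))
      (Complex.exp_ne_zero _) = 1 := by ext; simp
    exact (congrArg (· ^ b.repr (Pi.single i 1) j) h0).trans (one_zpow _)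
  · refine Eq.trans (congrArg (torusOfCoords b) (funext fun j => ?_))
      (torusOfCoords_monomialValue b x)
    ext
    simp only [Units.val_mk0, Complex.ofReal_one, one_mul]
    rw [Complex.exp_log (Units.ne_zero _)]

theorem continuous_evalAt (f : Laurent r) : Continuous (evalAt f) :=
  continuous_finsetSum _ fun l _ =>
    continuous_const.mul (Units.continuous_val.comp (continuous_monomialValue l))

theorem isClosed_of_isAlgebraicSet {A : Set (Torus r)} (hA : IsAlgebraicSet A) : IsClosed A := by
  obtain ⟨F, rfl⟩ := hA
  have : zeroLocus F = ⋂ f ∈ F, evalAt f ⁻¹' {0} := by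
    ext x
    simp [zeroLocus]
  rw [this]
  exact isClosed_biInter fun f _ => isClosed_singleton.preimage (continuous_evalAt f)

theorem IsPreconnected.isZariskiConnected {A : Set (Torus r)} (hA : IsPreconnected A) :
    IsZariskiConnected A := by
  intro B C hB hC hBC hd
  have h := isPreconnected_closed_iff.1 hA B C (isClosed_of_isAlgebraicSet hB)
    (isClosed_of_isAlgebraicSet hC) hBC.subset
  by_contra hne
  rw [not_or, ← ne_eq, ← ne_eq, ← Set.nonempty_iff_ne_empty, ← Set.nonempty_iff_ne_empty] at hne
  obtain ⟨x, -, hx⟩ := h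
    (by rw [hBC, Set.inter_eq_right.2 Set.subset_union_left]; exact hne.1)
    (by rw [hBC, Set.inter_eq_right.2 Set.subset_union_right]; exact hne.2)
  exact Set.disjoint_left.1 hd hx.1 hx.2

theorem evalAt_eq_sum_of_subset (f : Laurent r) (x : Torus r) {s : Finset (Fin r → ℤ)}
    (hs : exponents f ⊆ s) : evalAt f x = ∑ l ∈ s, f.coeff l * (monomialValue x l : ℂ) := by
  refine Finset.sum_subset hs fun l _ hl => ?_
  rw [Finsupp.notMem_support_iff.1 hl, zero_mul]

/-- The Laurent polynomial `t ^ l - u`. -/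
def binomial (l : Fin r → ℤ) (u : ℂ) : Laurent r :=
  AddMonoidAlgebra.single l 1 - AddMonoidAlgebra.single 0 u

theorem evalAt_binomial (l : Fin r → ℤ) (u : ℂ) (x : Torus r) :
    evalAt (binomial l u) x = monomialValue x l - u := by
  classical
  have hs : exponents (binomial l u) ⊆ {l, 0} := by
    intro m hm
    by_contra hne
    simp only [Finset.mem_insert, Finset.mem_singleton, not_or] at hne
    refine Finsupp.mem_support_iff.1 hm ?_
    simp [binomial, Ne.symm hne.1, Ne.symm hne.2]
  rw [evalAt_eq_sum_of_subset _ _ hs]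
  by_cases hl : l = 0
  · subst hl
    simp [binomial]
  · rw [Finset.sum_pair hl]
    simp [binomial, hl, Ne.symm hl, sub_eq_add_neg]

theorem isAlgebraicSet_setOf_monomialValue_eq (S : Set (Fin r → ℤ)) (u : (Fin r → ℤ) → ℂˣ) :
    IsAlgebraicSet {x : Torus r | ∀ l ∈ S, monomialValue x l = u l} := by
  refine ⟨(fun l => binomial l (u l)) '' S, ?_⟩
  ext x
  simp only [zeroLocus, Set.mem_ofPred_eq, Set.forall_mem_image, evalAt_binomial, sub_eq_zero]
  exact forall₂_congr fun l _ => Units.val_inj.symm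

/-- `V(E)` as a subgroup of the torus. -/
def subgroupLocusSubgroup (E : AddSubgroup (Fin r → ℤ)) : Subgroup (Torus r) where
  carrier := subgroupLocus E
  one_mem' l _ := monomialValue_one l
  mul_mem' := fun {x y} hx hy l hl => by rw [monomialValue_mul, hx l hl, hy l hl, one_mul]
  inv_mem' := fun {x} hx l hl => by rw [monomialValue_inv, hx l hl, inv_one]

theorem isAffineSubtorus_subgroupLocus_saturation (E : AddSubgroup (Fin r → ℤ)) :
    IsAffineSubtorus (subgroupLocusSubgroup (saturation E)) :=
  ⟨isAlgebraicSet_setOf_monomialValue_eq _ fun _ => 1,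
    (isPreconnected_subgroupLocus_saturation E).isZariskiConnected⟩

end Connected

section BlockSums

variable {r : ℕ} {f : Laurent r}

/-- All sums `∑_{l ∈ ν} a_l w_l` over the blocks `ν` of a partition vanish. -/
def BlockSumsVanish (P : Finpartition (exponents f)) (w : (Fin r → ℤ) → ℂ) : Prop :=
  ∀ ν ∈ P.parts, ∑ l ∈ ν, f.coeff l * w l = 0

theorem BlockSumsVanish.two_le_card {P : Finpartition (exponents f)} {w : (Fin r → ℤ) → ℂ}
    (h : BlockSumsVanish P w) (hw : ∀ l ∈ exponents f, w l ≠ 0) :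
    ∀ ν ∈ P.parts, 2 ≤ ν.card := by
  intro ν hν
  by_contra hlt
  have h1 : ν.card = 1 :=
    le_antisymm (by omega) (Finset.card_pos.2 (P.nonempty_of_mem_parts hν))
  obtain ⟨l, rfl⟩ := Finset.card_eq_one.1 h1
  have hl : l ∈ exponents f := P.le hν (Finset.mem_singleton_self l)
  have h2 := h _ hν
  rw [Finset.sum_singleton] at h2
  exact mul_ne_zero (Finsupp.mem_support_iff.1 hl) (hw l hl) h2

theorem BlockSumsVanish.sum_eq_zero {P : Finpartition (exponents f)} {w : (Fin r → ℤ) → ℂ}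
    (h : BlockSumsVanish P w) : ∑ l ∈ exponents f, f.coeff l * w l = 0 := by
  classical
  conv_lhs => rw [← P.biUnion_parts]
  rw [Finset.sum_biUnion P.disjoint]
  exact Finset.sum_eq_zero h

/-- A vanishing proper partial sum of a block yields a proper refinement. -/
theorem BlockSumsVanish.exists_lt {P : Finpartition (exponents f)} {w : (Fin r → ℤ) → ℂ}
    (h : BlockSumsVanish P w) {ν I : Finset (Fin r → ℤ)} (hν : ν ∈ P.parts) (hI : I ⊆ ν)
    (hne : I.Nonempty) (hIν : I ≠ ν) (h0 : ∑ l ∈ I, f.coeff l * w l = 0) :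
    ∃ Q : Finpartition (exponents f), Q < P ∧ BlockSumsVanish Q w := by
  classical
  set A := Finpartition.atomise (exponents f) {I}
  have hAparts : ∀ t ∈ A.parts, t = I ∨ t = exponents f \ I := by
    intro t ht
    obtain ⟨-, Q, -, rfl⟩ := Finpartition.mem_atomise.1 ht
    by_cases hQ : I ∈ Q
    · left
      ext l
      simp only [Finset.mem_filter, Finset.mem_singleton, forall_eq, hQ, true_iff,
        and_iff_right_iff_imp]
      exact fun hl => P.le hν (hI hl)
    · right
      ext l
      simp [hQ]
  refine ⟨P ⊓ A, lt_of_le_of_ne inf_le_left fun heq => ?_, ?_⟩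
  · rw [← heq, Finpartition.parts_inf, Finset.mem_erase, Finset.mem_image] at hν
    obtain ⟨-, ⟨μ, t⟩, hμ, hμt⟩ := hν
    rw [Finset.mem_product] at hμ
    change μ ∩ t = ν at hμt
    rcases hAparts t hμ.2 with ht | ht
    · exact hIν (hI.antisymm (by rw [← hμt, ht]; exact Finset.inter_subset_right))
    · obtain ⟨l, hl⟩ := hne
      have h1 := hI hl
      rw [← hμt, ht, Finset.mem_inter, Finset.mem_sdiff] at h1
      exact h1.2.2 hl
  · intro τ hτ
    rw [Finpartition.parts_inf, Finset.mem_erase, Finset.mem_image] at hτ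
    obtain ⟨hτ0, ⟨μ, t⟩, hμ, rfl⟩ := hτ
    rw [Finset.mem_product] at hμ
    change ∑ l ∈ μ ∩ t, f.coeff l * w l = 0
    have hinter : ∑ l ∈ μ ∩ I, f.coeff l * w l = 0 := by
      by_cases hμν : μ = ν
      · rw [hμν, Finset.inter_eq_right.2 hI, h0]
      · have hd : Disjoint μ I := (P.disjoint hμ.1 hν hμν).mono_right hI
        rw [Finset.disjoint_iff_inter_eq_empty.1 hd, Finset.sum_empty]
    rcases hAparts t hμ.2 with ht | ht
    · rw [ht, hinter]
    · have h1 : μ ∩ (exponents f \ I) = μ \ I := by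
        ext l
        simp only [Finset.mem_inter, Finset.mem_sdiff]
        exact ⟨fun h => ⟨h.1, h.2.2⟩, fun h => ⟨h.1, P.le hμ.1 h.1, h.2⟩⟩
      have h2 := Finset.sum_inter_add_sum_sdiff μ I fun l => f.coeff l * w l
      rw [hinter, zero_add, h μ hμ.1] at h2
      rw [ht, h1, h2]

/-- A vanishing sum splits along a finest partition with vanishing block sums. -/
theorem exists_minimal_blockSumsVanish {w : (Fin r → ℤ) → ℂ} (hw : ∀ l ∈ exponents f, w l ≠ 0)
    (h : ∑ l ∈ exponents f, f.coeff l * w l = 0) :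
    ∃ P : AdmissiblePartition f, BlockSumsVanish P.1 w ∧
      ∀ Q : Finpartition (exponents f), Q < P.1 → ¬ BlockSumsVanish Q w := by
  classical
  have hne : {P : Finpartition (exponents f) | BlockSumsVanish P w}.Nonempty := by
    refine ⟨⊤, fun ν hν => ?_⟩
    rw [Finset.mem_singleton.1 (Finpartition.parts_top_subset _ hν), h]
  obtain ⟨P, hP⟩ := (Set.toFinite _).exists_minimal hne
  exact ⟨⟨P, hP.1.two_le_card hw⟩, hP.1, fun Q hQ hv => hP.not_prop_of_lt hQ hv⟩

end BlockSums

section Solutions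

variable {r : ℕ} {f : Laurent r}

/-- Extension by zero of a point of the big torus. -/
def extendZero (y : BigTorus f) (l : Fin r → ℤ) : ℂ :=
  if h : l ∈ exponents f then (y ⟨l, h⟩ : ℂ) else 0

theorem extendZero_toExponent (y : BigTorus f) {P : AdmissiblePartition f} (ν : Block P)
    (l : {l // l ∈ ν.1}) : extendZero y l.1 = y (ν.toExponent l) :=
  dif_pos (P.1.le ν.2 l.2)

theorem extendZero_ne_zero (y : BigTorus f) {l : Fin r → ℤ} (hl : l ∈ exponents f) :
    extendZero y l ≠ 0 := by
  rw [extendZero, dif_pos hl]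
  exact Units.ne_zero _

theorem extendZero_alpha (x : Torus r) {l : Fin r → ℤ} (hl : l ∈ exponents f) :
    extendZero (alpha f x) l = monomialValue x l :=
  dif_pos hl

theorem mem_homogeneousSolutions_iff {P : AdmissiblePartition f} {y : BigTorus f} :
    y ∈ homogeneousSolutions P ↔ BlockSumsVanish P.1 (extendZero y) := by
  have h : ∀ ν : Block P, ∑ l : {l // l ∈ ν.1}, f.coeff l.1 * (y (ν.toExponent l) : ℂ) =
      ∑ l ∈ ν.1, f.coeff l * extendZero y l := by
    intro ν
    rw [← Finset.sum_coe_sort ν.1 fun l => f.coeff l * extendZero y l]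
    exact Finset.sum_congr rfl fun l _ => by rw [extendZero_toExponent]
  constructor
  · intro hy ν hν
    rw [← h ⟨ν, hν⟩]
    exact hy ⟨ν, hν⟩
  · intro hy ν
    rw [h]
    exact hy ν.1 ν.2

variable {P : AdmissiblePartition f} {c : BaseChoice P}

/-- `beta` determines the quotients of coordinates within a block. -/
theorem div_eq_div_of_beta_eq {y y' : BigTorus f} (h : beta P c y = beta P c y') (ν : Block P)
    (l : {l // l ∈ ν.1}) : y (ν.toExponent l) / y (ν.toExponent (c ν)) =
      y' (ν.toExponent l) / y' (ν.toExponent (c ν)) := by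
  by_cases hl : l = c ν
  · rw [hl, div_self', div_self']
  · exact congrFun (congrFun h ν) ⟨l, hl⟩

theorem homogeneousSolutions_of_beta_eq {y y' : BigTorus f} (h : beta P c y = beta P c y')
    {P' : AdmissiblePartition f} (hP' : P'.1 ≤ P.1) (hy : y ∈ homogeneousSolutions P') :
    y' ∈ homogeneousSolutions P' := by
  rw [mem_homogeneousSolutions_iff] at hy ⊢
  intro μ hμ
  obtain ⟨ν, hν, hμν⟩ := hP' hμ
  let ν' : Block P := ⟨ν, hν⟩
  have h1 : ∀ l ∈ μ, extendZero y' l = extendZero y l *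
      ((y' (ν'.toExponent (c ν')) : ℂ) / (y (ν'.toExponent (c ν')) : ℂ)) := by
    intro l hl
    have h2 := div_eq_div_of_beta_eq h ν' ⟨l, hμν hl⟩
    rw [div_eq_div_iff_mul_eq_mul, ← Units.val_inj, Units.val_mul, Units.val_mul] at h2
    rw [extendZero_toExponent y' ν' ⟨l, hμν hl⟩, extendZero_toExponent y ν' ⟨l, hμν hl⟩,
      ← mul_div_assoc, eq_div_iff (Units.ne_zero _), ← h2]
  rw [Finset.sum_congr rfl fun l hl => by rw [h1 l hl, ← mul_assoc], ← Finset.sum_mul, hy μ hμ,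
    zero_mul]

theorem beta_mem_solutions_iff {y : BigTorus f} :
    beta P c y ∈ solutions P c ↔ y ∈ homogeneousSolutions P := by
  classical
  refine forall_congr' fun ν => ?_
  have ha : f.coeff (c ν).1 ≠ 0 := Finsupp.mem_support_iff.1 (P.1.le ν.2 (c ν).2)
  have hy : (y (ν.toExponent (c ν)) : ℂ) ≠ 0 := Units.ne_zero _
  have h1 : ∑ l : {l : {l // l ∈ ν.1} // l ≠ c ν},
      (-f.coeff l.1.1 / f.coeff (c ν).1) * (beta P c y ν l : ℂ) =
      (∑ l : {l : {l // l ∈ ν.1} // l ≠ c ν}, f.coeff l.1.1 * (y (ν.toExponent l.1) : ℂ)) *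
        (-1 / (f.coeff (c ν).1 * y (ν.toExponent (c ν)))) := by
    rw [Finset.sum_mul]
    refine Finset.sum_congr rfl fun l _ => ?_
    rw [beta, Units.val_div_eq_div_val]
    field_simp
  have h2 := Fintype.sum_subtype_add_sum_subtype (fun l => l ≠ c ν)
    fun l : {l // l ∈ ν.1} => f.coeff l.1 * (y (ν.toExponent l) : ℂ)
  have h3 : ∑ l : {l : {l // l ∈ ν.1} // ¬ l ≠ c ν}, f.coeff l.1.1 * (y (ν.toExponent l.1) : ℂ) =
      f.coeff (c ν).1 * y (ν.toExponent (c ν)) := by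
    rw [Fintype.sum_eq_single ⟨c ν, by simp⟩]
    rintro ⟨l, hl⟩ hne
    exact absurd (Subtype.ext (not_not.1 hl)) hne
  rw [h3] at h2
  rw [h1, ← h2, mul_div_assoc', div_eq_one_iff_eq (mul_ne_zero ha hy)]
  constructor <;> intro h
  · rw [← h]; ring
  · linear_combination -h

theorem mem_maximalSolutions_beta_iff {y : BigTorus f} :
    beta P c y ∈ maximalSolutions P c ↔ BlockSumsVanish P.1 (extendZero y) ∧
      ∀ Q : Finpartition (exponents f), Q < P.1 → ¬ BlockSumsVanish Q (extendZero y) := by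
  rw [maximalSolutions, Set.mem_ofPred_eq, beta_mem_solutions_iff, mem_homogeneousSolutions_iff]
  refine and_congr_right fun _ => ⟨fun h Q hQ hv => ?_, fun h P' hP' y' hy' hv => ?_⟩
  · let P' : AdmissiblePartition f :=
      ⟨Q, hv.two_le_card fun l hl => extendZero_ne_zero y hl⟩
    exact h P' hQ y rfl (mem_homogeneousSolutions_iff.2 hv)
  · exact h P'.1 hP' (mem_homogeneousSolutions_iff.1 (homogeneousSolutions_of_beta_eq hy' hP'.le hv))

/-- Every point of the reduced torus has a preimage whose base coordinates are `1`. -/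
theorem exists_beta_eq (z : ReducedTorus P c) : ∃ y : BigTorus f, beta P c y = z ∧
    ∀ (ν : Block P) (l : {l // l ∈ ν.1}),
      (l = c ν → y (ν.toExponent l) = 1) ∧
      ∀ h : l ≠ c ν, y (ν.toExponent l) = z ν ⟨l, h⟩ := by
  classical
  let blk : {l // l ∈ exponents f} → Block P := fun l => ⟨P.1.part l.1, P.1.part_mem.2 l.2⟩
  have hblk : ∀ l : {l // l ∈ exponents f}, l.1 ∈ (blk l).1 := fun l => P.1.mem_part l.2
  let F : (l : Fin r → ℤ) → (ν : Block P) → l ∈ ν.1 → ℂˣ := fun l ν hl =>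
    if h : (⟨l, hl⟩ : {l // l ∈ ν.1}) = c ν then 1 else z ν ⟨⟨l, hl⟩, h⟩
  have hF : ∀ l ν ν' (h : l ∈ ν.1) (h' : l ∈ ν'.1), ν = ν' → F l ν h = F l ν' h' := by
    rintro l ν _ h h' rfl
    rfl
  let y : BigTorus f := fun l => F l.1 (blk l) (hblk l)
  have hy : ∀ (ν : Block P) (l : {l // l ∈ ν.1}), y (ν.toExponent l) = F l.1 ν l.2 :=
    fun ν l => hF _ _ _ _ _ (Subtype.ext (P.1.part_eq_of_mem ν.2 l.2))
  have hspec : ∀ (ν : Block P) (l : {l // l ∈ ν.1}),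
      (l = c ν → y (ν.toExponent l) = 1) ∧
      ∀ h : l ≠ c ν, y (ν.toExponent l) = z ν ⟨l, h⟩ := by
    intro ν l
    constructor
    · intro h
      rw [hy]
      exact dif_pos h
    · intro h
      rw [hy]
      exact dif_neg h
  refine ⟨y, ?_, hspec⟩
  funext ν l
  rw [beta, (hspec ν l.1).2 l.2, (hspec ν (c ν)).1 rfl, div_one]

theorem isOfFinOrder_pi_apply {ι : Type*} {G : ι → Type*} [∀ i, Group (G i)] {x : ∀ i, G i}
    (hx : IsOfFinOrder x) (i : ι) : IsOfFinOrder (x i) :=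
  (Pi.evalMonoidHom G i).isOfFinOrder hx

/-- The set `S(P, f)` is finite. -/
theorem finite_torsionSolutions (P : AdmissiblePartition f) (c : BaseChoice P) :
    (torsionSolutions P c).Finite := by
  classical
  choose R hR0 hR using fun ν : Block P =>
    exists_pow_eq_one_of_nondegenerate (fun l : {l // l ∈ ν.1} => f.coeff l.1) (c ν)
  have hroots : ∀ n : ℕ, 0 < n → {u : ℂˣ | u ^ n = 1}.Finite := fun n hn =>
    Nat.finite_of_card_ne_zero (by
      change Nat.card {u : ℂˣ // u ^ n = 1} ≠ 0
      rw [card_units_pow_eq_one hn]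
      exact hn.ne')
  refine Set.Finite.subset (s := {z : ReducedTorus P c | ∀ ν, z ν ∈ {w | ∀ l, w l ^ R ν = 1}})
    (Set.Finite.pi' fun ν => Set.Finite.pi' fun l => hroots (R ν) (hR0 ν)) ?_
  rintro z ⟨hz, hfin⟩ ν l
  obtain ⟨y, rfl, hy⟩ := exists_beta_eq z
  obtain ⟨hv, hmin⟩ := mem_maximalSolutions_beta_iff.1 hz
  have key := hR ν (fun l => (y (ν.toExponent l) : ℂ)) ?_ ?_ ?_ ?_ l.1
  · rw [← (hy ν l.1).2 l.2]
    ext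
    rw [Units.val_pow_eq_pow_val, key, Units.val_one]
  · intro l
    by_cases hl : l = c ν
    · simp [(hy ν l).1 hl]
    · rw [(hy ν l).2 hl]
      exact (Units.coeHom ℂ).isOfFinOrder
        (isOfFinOrder_pi_apply (isOfFinOrder_pi_apply hfin ν) ⟨l, hl⟩)
  · simp [(hy ν (c ν)).1 rfl]
  · exact mem_homogeneousSolutions_iff.2 hv ν
  · intro I hI hIuniv h0
    have hmap : ∑ l ∈ I.map (Function.Embedding.subtype _), f.coeff l * extendZero y l = 0 := by
      rw [Finset.sum_map, ← h0]
      exact Finset.sum_congr rfl fun l _ => by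
        rw [← extendZero_toExponent]; rfl
    obtain ⟨Q, hQ, hQv⟩ := hv.exists_lt ν.2 (I := I.map (Function.Embedding.subtype _))
      (fun l hl => by
        obtain ⟨m, -, rfl⟩ := Finset.mem_map.1 hl
        exact m.2) (hI.map) (fun heq => hIuniv (Finset.eq_univ_iff_forall.2 fun l => by
          have hl : l.1 ∈ I.map (Function.Embedding.subtype _) := heq.symm.subset l.2
          simpa using hl)) hmap
    exact hmin Q hQ hQv

end Solutions

section Psi

variable {r : ℕ} {f : Laurent r} {P : AdmissiblePartition f} {c : BaseChoice P}

theorem psi_pow (x : Torus r) (n : ℕ) : psi P c (x ^ n) = psi P c x ^ n := by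
  funext ν l
  simp only [psi, beta, alpha, monomialValue_pow, Pi.pow_apply, div_pow]

theorem psi_one : psi P c (1 : Torus r) = 1 := by
  funext ν l
  simp [psi, beta, alpha]

theorem psi_eq_iff (x y : Torus r) :
    psi P c x = psi P c y ↔ ∀ l ∈ differenceGroup P, monomialValue x l = monomialValue y l := by
  constructor
  · intro h l hl
    refine monomialValue_eq_of_mem_closure ?_ hl
    rintro _ ⟨ν, hν, l, hl, m, hm, rfl⟩
    have h1 := div_eq_div_of_beta_eq h ⟨ν, hν⟩ ⟨l, hl⟩
    have h2 := div_eq_div_of_beta_eq h ⟨ν, hν⟩ ⟨m, hm⟩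
    change monomialValue x l / monomialValue x (c ⟨ν, hν⟩).1 =
      monomialValue y l / monomialValue y (c ⟨ν, hν⟩).1 at h1
    change monomialValue x m / monomialValue x (c ⟨ν, hν⟩).1 =
      monomialValue y m / monomialValue y (c ⟨ν, hν⟩).1 at h2
    rw [monomialValue_sub, monomialValue_sub,
      ← div_div_div_cancel_right _ _ (monomialValue x (c ⟨ν, hν⟩).1), h1, h2,
      div_div_div_cancel_right]
  · intro h
    funext ν l
    have h1 := h (l.1.1 - (c ν).1)
      (AddSubgroup.subset_closure ⟨ν.1, ν.2, l.1.1, l.1.2, (c ν).1, (c ν).2, rfl⟩)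
    rwa [monomialValue_sub, monomialValue_sub] at h1

theorem mem_hypersurface_of_psi_mem {x : Torus r} (h : psi P c x ∈ torsionSolutions P c) :
    x ∈ hypersurface f := by
  have h1 := (mem_maximalSolutions_beta_iff.1 h.1).1.sum_eq_zero
  change evalAt f x = 0
  rw [evalAt, ← h1]
  exact Finset.sum_congr rfl fun l hl => by rw [extendZero_alpha x hl]

theorem exists_psi_mem_of_mem_hypersurface (c : ∀ P : AdmissiblePartition f, BaseChoice P)
    {x : Torus r} (hx : x ∈ hypersurface f) (hfin : IsOfFinOrder x) :
    ∃ P : AdmissiblePartition f, psi P (c P) x ∈ torsionSolutions P (c P) := by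
  obtain ⟨P, h1, h2⟩ := exists_minimal_blockSumsVanish (f := f) (w := extendZero (alpha f x))
    (fun l hl => extendZero_ne_zero _ hl) (by
      rw [← show evalAt f x = 0 from hx, evalAt]
      exact Finset.sum_congr rfl fun l hl => by rw [extendZero_alpha x hl])
  refine ⟨P, mem_maximalSolutions_beta_iff.2 ⟨h1, h2⟩, ?_⟩
  obtain ⟨n, hn, hxn⟩ := isOfFinOrder_iff_pow_eq_one.1 hfin
  exact isOfFinOrder_iff_pow_eq_one.2 ⟨n, hn, by rw [← psi_pow, hxn, psi_one]⟩

theorem orderLcm_pos_and_dvd (P : AdmissiblePartition f) (c : BaseChoice P) :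
    0 < orderLcm P c ∧ ∀ z ∈ torsionSolutions P c, orderOf z ∣ orderLcm P c := by
  refine Nat.sInf_mem (s := {m : ℕ | 0 < m ∧ ∀ x ∈ torsionSolutions P c, orderOf x ∣ m})
    ⟨∏ z ∈ (finite_torsionSolutions P c).toFinset, orderOf z, ?_, ?_⟩
  · exact Finset.prod_pos fun z hz => (((Set.Finite.mem_toFinset _).1 hz).2).orderOf_pos
  · exact fun z hz => Finset.dvd_prod_of_mem _ ((Set.Finite.mem_toFinset _).2 hz)

end Psi

section RationalPlanes

variable {r : ℕ}

theorem evalAt_add (f g : Laurent r) (x : Torus r) :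
    evalAt (f + g) x = evalAt f x + evalAt g x := by
  classical
  have h : exponents (f + g) ⊆ exponents f ∪ exponents g := Finsupp.support_add
  rw [evalAt_eq_sum_of_subset _ x h,
    evalAt_eq_sum_of_subset f x (Finset.subset_union_left (s₂ := exponents g)),
    evalAt_eq_sum_of_subset g x (Finset.subset_union_right (s₁ := exponents f)),
    ← Finset.sum_add_distrib]
  exact Finset.sum_congr rfl fun l _ => add_mul _ _ _

theorem evalAt_zero (x : Torus r) : evalAt (0 : Laurent r) x = 0 := by
  simp [evalAt]

theorem evalAt_single (l : Fin r → ℤ) (u : ℂ) (x : Torus r) :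
    evalAt (AddMonoidAlgebra.single l u : Laurent r) x = u * monomialValue x l := by
  classical
  have hs : exponents (AddMonoidAlgebra.single l u : Laurent r) ⊆ {l} :=
    Finsupp.support_single_subset
  rw [evalAt_eq_sum_of_subset _ _ hs]
  simp

theorem evalAt_sum {ι : Type*} (s : Finset ι) (f : ι → Laurent r) (x : Torus r) :
    evalAt (∑ i ∈ s, f i) x = ∑ i ∈ s, evalAt (f i) x := by
  classical
  induction s using Finset.induction_on with
  | empty => simp [evalAt_zero]
  | insert i s hi ih => rw [Finset.sum_insert hi, Finset.sum_insert hi, evalAt_add, ih]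

theorem isAlgebraicSet_inter_evalAt_eq_zero {A : Set (Torus r)} (hA : IsAlgebraicSet A)
    (g : Laurent r) : IsAlgebraicSet (A ∩ {x | evalAt g x = 0}) := by
  obtain ⟨F, rfl⟩ := hA
  refine ⟨insert g F, ?_⟩
  ext x
  simp only [zeroLocus, Set.mem_inter_iff, Set.mem_ofPred_eq, Set.forall_mem_insert]
  exact and_comm

/-- A connected algebraic subgroup on which `t ^ l` takes finitely many values lies in `t ^ l = 1`. -/
theorem monomialValue_eq_one_of_isAffineSubtorus {H : Subgroup (Torus r)} (hH : IsAffineSubtorus H)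
    {l : Fin r → ℤ} {n : ℕ} (hn : 0 < n) (hl : ∀ x ∈ H, monomialValue x l ^ n = 1) :
    ∀ x ∈ H, monomialValue x l = 1 := by
  have hpow : ∀ x ∈ H, (monomialValue x l : ℂ) ^ n = 1 := fun x hx => by
    rw [← Units.val_pow_eq_pow_val, hl x hx, Units.val_one]
  let g : Laurent r := ∑ i ∈ Finset.range n, AddMonoidAlgebra.single (i • l) 1
  have hg : ∀ x, evalAt g x = ∑ i ∈ Finset.range n, (monomialValue x l : ℂ) ^ i := by
    intro x
    rw [evalAt_sum]
    exact Finset.sum_congr rfl fun i _ => by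
      rw [evalAt_single, monomialValue_nsmul, one_mul, Units.val_pow_eq_pow_val]
  have hbin : ∀ x, evalAt (binomial l 1) x = 0 ↔ (monomialValue x l : ℂ) = 1 := fun x => by
    rw [evalAt_binomial, sub_eq_zero]
  have hone : ∀ x, (monomialValue x l : ℂ) = 1 → evalAt g x ≠ 0 := by
    intro x hx
    rw [hg, hx]
    simp [hn.ne']
  have h := hH.2 _ _ (isAlgebraicSet_inter_evalAt_eq_zero hH.1 (binomial l 1))
    (isAlgebraicSet_inter_evalAt_eq_zero hH.1 g) ?_ ?_
  · rcases h with h | h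
    · have : (1 : Torus r) ∈ (∅ : Set (Torus r)) := by
        rw [← h]
        exact ⟨H.one_mem, (hbin 1).2 (by simp)⟩
      exact absurd this (Set.notMem_empty _)
    · intro x hx
      by_contra hne
      have h1 := geom_sum_mul (monomialValue x l : ℂ) n
      rw [hpow x hx, sub_self] at h1
      have h2 : (monomialValue x l : ℂ) - 1 ≠ 0 := fun h2 =>
        hne (Units.ext (sub_eq_zero.1 h2))
      have h3 : x ∈ (H : Set (Torus r)) ∩ {x | evalAt g x = 0} :=
        ⟨hx, (hg x).trans ((mul_eq_zero.1 h1).resolve_right h2)⟩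
      rw [h] at h3
      exact h3
  · ext x
    refine ⟨fun hx => ?_, fun hx => hx.elim (fun h => h.1) fun h => h.1⟩
    by_cases h1 : (monomialValue x l : ℂ) = 1
    · exact Or.inl ⟨hx, (hbin x).2 h1⟩
    · refine Or.inr ⟨hx, (hg x).trans ?_⟩
      have h2 := geom_sum_mul (monomialValue x l : ℂ) n
      rw [hpow x hx, sub_self] at h2
      exact (mul_eq_zero.1 h2).resolve_right (sub_ne_zero.2 h1)
  · rw [Set.disjoint_left]
    rintro x ⟨-, hx⟩ ⟨-, hx'⟩
    exact hone x ((hbin x).1 hx) hx'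

/-- The monomial `t ^ l` as a character of a subgroup of the torus. -/
def monomialCharacter (H : Subgroup (Torus r)) (l : Fin r → ℤ) : H →* ℂ where
  toFun x := (monomialValue (x : Torus r) l : ℂ)
  map_one' := by simp
  map_mul' x y := by simp [monomialValue_mul]

/-- If a translate of `H` lies in `V(f)`, then the partial sums of `f` over the exponents which
agree as characters of `H` vanish. -/
theorem exists_partition_of_translate_subset {f : Laurent r} {H : Subgroup (Torus r)} {η : Torus r}
    (h : torusTranslate η (H : Set (Torus r)) ⊆ hypersurface f) :
    ∃ P : AdmissiblePartition f, BlockSumsVanish P.1 (fun l => monomialValue η l) ∧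
      (H : Set (Torus r)) ⊆ subgroupLocus (differenceGroup P) := by
  classical
  let χ := monomialCharacter H
  let P : Finpartition (exponents f) := Finpartition.ofSetSetoid (Setoid.ker χ) (exponents f)
  have hparts : ∀ ν ∈ P.parts, ∃ a ∈ exponents f, ν = {b ∈ exponents f | χ a = χ b} := by
    intro ν hν
    obtain ⟨a, ha, rfl⟩ := Finset.mem_image.1 hν
    exact ⟨a, ha, rfl⟩
  have hv : BlockSumsVanish P (fun l => monomialValue η l) := by
    let C : (H →* ℂ) → ℂ := fun ψ =>
      ∑ l ∈ exponents f with χ l = ψ, f.coeff l * (monomialValue η l : ℂ)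
    have hsum : ∑ ψ ∈ (exponents f).image χ, C ψ • (ψ : H → ℂ) = 0 := by
      funext x
      have h1 : evalAt f (η * x) = 0 := h ⟨x, x.2, rfl⟩
      rw [evalAt, ← Finset.sum_fiberwise_of_maps_to (g := χ)
        (fun l hl => Finset.mem_image_of_mem χ hl)] at h1
      rw [Finset.sum_apply, Pi.zero_apply, ← h1]
      refine Finset.sum_congr rfl fun ψ _ => ?_
      rw [Pi.smul_apply, smul_eq_mul, Finset.sum_mul]
      refine Finset.sum_congr rfl fun l hl => ?_
      rw [← (Finset.mem_filter.1 hl).2, monomialValue_mul, Units.val_mul, ← mul_assoc]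
      rfl
    have hli := linearIndependent_iff'.1 (linearIndependent_monoidHom H ℂ) _ C hsum
    intro ν hν
    obtain ⟨a, ha, rfl⟩ := hparts ν hν
    rw [← hli (χ a) (Finset.mem_image_of_mem χ ha)]
    exact Finset.sum_congr (Finset.filter_congr fun _ _ => eq_comm) fun _ _ => rfl
  refine ⟨⟨P, hv.two_le_card fun l _ => Units.ne_zero _⟩, hv, fun x hx l hl => ?_⟩
  rw [← monomialValue_one l]
  refine monomialValue_eq_of_mem_closure ?_ hl
  rintro _ ⟨ν, hν, l, hl, m, hm, rfl⟩
  obtain ⟨a, -, rfl⟩ := hparts ν hν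
  have h1 : χ l = χ m := (Finset.mem_filter.1 hl).2.symm.trans (Finset.mem_filter.1 hm).2
  have h2 : monomialValue x l = monomialValue x m :=
    Units.ext (DFunLike.congr_fun h1 (⟨x, hx⟩ : H))
  rw [monomialValue_sub, h2, div_self', monomialValue_one]

theorem translate_subgroupLocus_subset {f : Laurent r} {P : AdmissiblePartition f} {η : Torus r}
    (hv : BlockSumsVanish P.1 (fun l => monomialValue η l)) :
    torusTranslate η (subgroupLocus (differenceGroup P)) ⊆ hypersurface f := by
  rintro _ ⟨x, hx, rfl⟩
  refine BlockSumsVanish.sum_eq_zero (P := P.1) (w := fun l => monomialValue (η * x) l) ?_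
  intro ν hν
  obtain ⟨m, hm⟩ := P.1.nonempty_of_mem_parts hν
  rw [← zero_mul (monomialValue x m : ℂ), ← hv ν hν, Finset.sum_mul]
  refine Finset.sum_congr rfl fun l hl => ?_
  have h1 := hx _ (AddSubgroup.subset_closure ⟨ν, hν, l, hl, m, hm, rfl⟩)
  rw [monomialValue_sub, div_eq_one] at h1
  simp only [monomialValue_mul, Units.val_mul, h1, mul_assoc]

theorem subgroupLocus_anti {E F : AddSubgroup (Fin r → ℤ)} (h : E ≤ F) :
    subgroupLocus F ⊆ subgroupLocus E := fun _ hx l hl => hx l (h hl)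

theorem exists_eq_translate_of_isMaximalRationalPlaneIn {f : Laurent r} {Q : Set (Torus r)}
    (hQ : IsMaximalRationalPlaneIn Q (hypersurface f)) :
    ∃ (P : AdmissiblePartition f) (η : Torus r),
      Q = torusTranslate η (subgroupLocus (saturation (differenceGroup P))) := by
  obtain ⟨⟨H, η, hH, hη, rfl⟩, hsub⟩ := hQ.prop
  obtain ⟨P, hv, hHP⟩ := exists_partition_of_translate_subset hsub
  have hsat : (H : Set (Torus r)) ⊆ subgroupLocus (saturation (differenceGroup P)) := by
    rintro x hx l ⟨n, hn, hl⟩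
    refine monomialValue_eq_one_of_isAffineSubtorus hH hn (fun y hy => ?_) x hx
    rw [← monomialValue_nsmul]
    exact hHP hy _ hl
  refine ⟨P, η, hQ.eq_of_le ⟨⟨subgroupLocusSubgroup _, η,
    isAffineSubtorus_subgroupLocus_saturation (differenceGroup P), hη, rfl⟩, ?_⟩
    (Set.image_mono hsat)⟩
  exact (Set.image_mono (subgroupLocus_anti (le_saturation _))).trans
    (translate_subgroupLocus_subset hv)

end RationalPlanes

section Expansions

theorem periodic_nat_mul {α : Type*} {g : ℕ → α} {K : ℕ} (h : Function.Periodic g K) (n : ℕ) :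
    Function.Periodic g (n * K) := by
  simpa using h.nat_mul n

theorem exists_common_period {p : ℕ → ℕ} {a : ℕ →₀ (ℕ → ℂ)}
    (h : IsPolynomialPeriodicExpansion p a) : ∃ C : ℕ, 0 < C ∧ ∀ i, Function.Periodic (a i) C := by
  choose c hc0 hc using h.1
  refine ⟨∏ i ∈ a.support, c i, Finset.prod_pos fun i _ => hc0 i, fun i => ?_⟩
  by_cases hi : i ∈ a.support
  · obtain ⟨q, hq⟩ := Finset.dvd_prod_of_mem c hi
    rw [hq, mul_comm]
    exact periodic_nat_mul (hc i) q
  · rw [Finsupp.notMem_support_iff.1 hi]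
    exact fun _ => rfl

open Polynomial in
/-- The functions `a_i` in a polynomial periodic expansion are determined by the expansion. -/
theorem expansion_unique {p : ℕ → ℕ} {a b : ℕ →₀ (ℕ → ℂ)}
    (ha : IsPolynomialPeriodicExpansion p a) (hb : IsPolynomialPeriodicExpansion p b) : a = b := by
  obtain ⟨C, hC, hCa⟩ := exists_common_period ha
  obtain ⟨C', hC', hCb⟩ := exists_common_period hb
  let poly : (ℕ →₀ (ℕ → ℂ)) → ℕ → ℂ[X] := fun a n => ∑ i ∈ a.support, monomial i (a i n)
  have hcoeff : ∀ (a : ℕ →₀ (ℕ → ℂ)) (n i : ℕ), (poly a n).coeff i = a i n := by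
    intro a n i
    simp only [poly, finsetSum_coeff, coeff_monomial]
    rw [Finset.sum_ite_eq']
    split_ifs with h
    · rfl
    · rw [Finsupp.notMem_support_iff.1 h, Pi.zero_apply]
  have heval : ∀ a : ℕ →₀ (ℕ → ℂ), IsPolynomialPeriodicExpansion p a → ∀ N : ℕ, 0 < N →
      (∀ i, Function.Periodic (a i) N) → ∀ n k : ℕ,
      (poly a n).eval ((n + (k + 1) * N : ℕ) : ℂ) = p (n + (k + 1) * N) := by
    intro a ha N hN hp n k
    rw [ha.2 _ (by nlinarith)]
    simp only [poly, eval_finsetSum, eval_monomial]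
    exact Finset.sum_congr rfl fun i _ => by rw [periodic_nat_mul (hp i) (k + 1) n]
  have hpoly : ∀ n, poly a n = poly b n := by
    intro n
    have hN : 0 < C * C' := Nat.mul_pos hC hC'
    refine eq_of_infinite_eval_eq _ _ (Set.infinite_of_injective_forall_mem
      (f := fun k : ℕ => ((n + (k + 1) * (C * C') : ℕ) : ℂ)) ?_ fun k => ?_)
    · intro k k' h
      have h1 := Nat.cast_injective (R := ℂ) h
      have h2 := Nat.eq_of_mul_eq_mul_right hN (Nat.add_left_cancel h1)
      omega
    · rw [Set.mem_ofPred_eq,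
        heval a ha _ hN (fun i => by rw [mul_comm]; exact periodic_nat_mul (hCa i) C'),
        heval b hb _ hN (fun i => periodic_nat_mul (hCb i) C)]
  ext i n
  rw [← hcoeff a n i, hpoly, hcoeff]

theorem leastPeriod_dvd {g : ℕ → ℂ} {K : ℕ} (hK : 0 < K) (h : Function.Periodic g K) :
    leastPeriod g ∣ K := by
  obtain ⟨h0, hp⟩ : 0 < leastPeriod g ∧ Function.Periodic g (leastPeriod g) :=
    Nat.sInf_mem (s := {c : ℕ | 0 < c ∧ Function.Periodic g c}) ⟨K, hK, h⟩
  by_contra hd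
  have hmod : 0 < K % leastPeriod g := Nat.pos_of_ne_zero fun h => hd (Nat.dvd_of_mod_eq_zero h)
  have hper : Function.Periodic g (K % leastPeriod g) := by
    intro x
    rw [← periodic_nat_mul hp (K / leastPeriod g) (x + K % leastPeriod g), add_assoc, mul_comm,
      Nat.mod_add_div, h]
  exact absurd (Nat.sInf_le (s := {c : ℕ | 0 < c ∧ Function.Periodic g c}) ⟨hmod, hper⟩)
    (not_le.2 (Nat.mod_lt _ h0))

/-- A sum of terms `g_t(n) n ^ k_t` with periodic `g_t` has a polynomial periodic expansion. -/
theorem exists_expansion_of_sum {τ : Type*} [Fintype τ] {p : ℕ → ℕ} {k : τ → ℕ} {g : τ → ℕ → ℂ}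
    {K : ℕ} (hK : 0 < K) (hg : ∀ t, Function.Periodic (g t) K)
    (hp : ∀ n : ℕ, 1 ≤ n → (p n : ℂ) = ∑ t, g t n * (n : ℂ) ^ k t) :
    ∃ a : ℕ →₀ (ℕ → ℂ), IsPolynomialPeriodicExpansion p a ∧ (∀ i, Function.Periodic (a i) K) ∧
      ∀ i ∈ a.support, ∃ t n, k t = i ∧ g t n ≠ 0 := by
  classical
  have hne : ∀ i, (∑ t with k t = i, g t) ≠ 0 → ∃ t n, k t = i ∧ g t n ≠ 0 := by
    intro i hi
    obtain ⟨t, ht, hgt⟩ := Finset.exists_ne_zero_of_sum_ne_zero hi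
    obtain ⟨n, hn⟩ := Function.ne_iff.1 hgt
    exact ⟨t, n, (Finset.mem_filter.1 ht).2, hn⟩
  let a : ℕ →₀ (ℕ → ℂ) := Finsupp.onFinset (Finset.univ.image k) (fun i => ∑ t with k t = i, g t)
    fun i hi => by
      obtain ⟨t, -, ht, -⟩ := hne i hi
      exact Finset.mem_image.2 ⟨t, Finset.mem_univ t, ht⟩
  have ha : ∀ i, a i = ∑ t with k t = i, g t := fun _ => rfl
  have hper : ∀ i, Function.Periodic (a i) K := by
    intro i n
    rw [ha, Finset.sum_apply, Finset.sum_apply]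
    exact Finset.sum_congr rfl fun t _ => hg t n
  refine ⟨a, ⟨fun i => ⟨K, hK, hper i⟩, fun n hn => ?_⟩, hper, fun i hi =>
    hne i (Finsupp.mem_support_iff.1 hi)⟩
  rw [hp n hn, ← Finset.sum_fiberwise_of_maps_to (g := k) (t := Finset.univ.image k)
    (fun t _ => Finset.mem_image_of_mem k (Finset.mem_univ t))]
  rw [Finset.sum_subset (Finsupp.support_onFinset_subset : a.support ⊆ Finset.univ.image k)]
  · refine Finset.sum_congr rfl fun i _ => ?_
    rw [ha, Finset.sum_apply, Finset.sum_mul]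
    exact Finset.sum_congr rfl fun t ht => by rw [(Finset.mem_filter.1 ht).2]
  · intro i _ hi
    rw [Finsupp.notMem_support_iff.1 hi, Pi.zero_apply, zero_mul]

/-- A polynomial periodic function which is at least `n ^ d` along the multiples of `K` has degree
at least `d`. -/
theorem le_expansionDegree {p : ℕ → ℕ} {a : ℕ →₀ (ℕ → ℂ)}
    (h : IsPolynomialPeriodicExpansion p a) {K d : ℕ} (hK : 0 < K)
    (hper : ∀ i, Function.Periodic (a i) K) (hp : ∀ m : ℕ, 0 < m → (m * K) ^ d ≤ p (m * K)) :
    d ≤ expansionDegree a := by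
  by_contra! hlt
  obtain ⟨e, rfl⟩ : ∃ e, d = e + 1 := Nat.exists_eq_succ_of_ne_zero (by omega)
  obtain ⟨m, hm⟩ := exists_nat_gt (∑ i ∈ a.support, ‖a i 0‖)
  have hm0 : 0 < m := by
    have : (0 : ℝ) < m := (Finset.sum_nonneg fun i _ => norm_nonneg _).trans_lt hm
    exact_mod_cast this
  have hn : 1 ≤ m * K := Nat.mul_pos hm0 hK
  have hn' : (1 : ℝ) ≤ ((m * K : ℕ) : ℝ) := by exact_mod_cast hn
  have h1 : ((m * K : ℕ) : ℝ) ^ (e + 1) ≤ ∑ i ∈ a.support, ‖a i 0‖ * ((m * K : ℕ) : ℝ) ^ e :=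
    calc ((m * K : ℕ) : ℝ) ^ (e + 1) ≤ (p (m * K) : ℝ) := by exact_mod_cast hp m hm0
      _ = ‖(p (m * K) : ℂ)‖ := (Complex.norm_natCast _).symm
      _ ≤ ∑ i ∈ a.support, ‖a i (m * K) * ((m * K : ℕ) : ℂ) ^ i‖ := by
        rw [h.2 _ hn]
        exact norm_sum_le _ _
      _ ≤ _ := by
        refine Finset.sum_le_sum fun i hi => ?_
        have h0 : a i (m * K) = a i 0 := by
          have := periodic_nat_mul (hper i) m 0
          rwa [zero_add] at this
        have hie : i ≤ e :=
          Nat.lt_succ_iff.1 (lt_of_le_of_lt (Finset.le_sup (f := id) hi : i ≤ _) hlt)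
        rw [norm_mul, norm_pow, Complex.norm_natCast, h0]
        exact mul_le_mul_of_nonneg_left (pow_le_pow_right₀ hn' hie) (norm_nonneg _)
  rw [← Finset.sum_mul, pow_succ'] at h1
  have h2 := le_of_mul_le_mul_right h1 (pow_pos (one_pos.trans_le hn') e)
  have h3 : (m : ℝ) ≤ ((m * K : ℕ) : ℝ) := by exact_mod_cast Nat.le_mul_of_pos_right m hK
  linarith

end Expansions

section Counting

variable {r : ℕ} {f : Laurent r} (c : ∀ P : AdmissiblePartition f, BaseChoice P)

/-- The pairs `(P, z)` with `z ∈ S(P, f)`. -/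
def allTorsionSolutions : Finset (Σ P : AdmissiblePartition f, ReducedTorus P (c P)) :=
  Finset.univ.sigma fun P => (finite_torsionSolutions P (c P)).toFinset

theorem mem_allTorsionSolutions {i : Σ P : AdmissiblePartition f, ReducedTorus P (c P)} :
    i ∈ allTorsionSolutions c ↔ i.2 ∈ torsionSolutions i.1 (c i.1) := by
  simp [allTorsionSolutions]

/-- The points mapped to `z` by `psi_P` for all `(P, z)` in a given set. -/
def commonFiber (Y : Finset (Σ P : AdmissiblePartition f, ReducedTorus P (c P))) :
    Set (Torus r) :=
  {x | ∀ i ∈ Y, psi i.1 (c i.1) x = i.2}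

open Classical in
/-- The group `ε(U, f)` of the set `U` of partitions occurring in a set of pairs `(P, z)`. -/
def pairsDifferenceGroup (Y : Finset (Σ P : AdmissiblePartition f, ReducedTorus P (c P))) :
    AddSubgroup (Fin r → ℤ) :=
  differenceGroupOfSet (Y.image Sigma.fst)

variable {c}

theorem differenceGroup_le_pairsDifferenceGroup
    {Y : Finset (Σ P : AdmissiblePartition f, ReducedTorus P (c P))}
    {i : Σ P : AdmissiblePartition f, ReducedTorus P (c P)} (hi : i ∈ Y) :
    differenceGroup i.1 ≤ pairsDifferenceGroup c Y := by
  classical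
  intro l hl
  refine AddSubgroup.subset_closure (Set.mem_biUnion (x := i.1) ?_ hl)
  exact Finset.mem_image_of_mem _ hi

theorem pairsDifferenceGroup_singleton
    (i : Σ P : AdmissiblePartition f, ReducedTorus P (c P)) :
    pairsDifferenceGroup c {i} = differenceGroup i.1 := by
  classical
  simp [pairsDifferenceGroup, differenceGroupOfSet]

theorem forall_psi_eq_iff {Y : Finset (Σ P : AdmissiblePartition f, ReducedTorus P (c P))}
    (x y : Torus r) : (∀ i ∈ Y, psi i.1 (c i.1) x = psi i.1 (c i.1) y) ↔
      ∀ l ∈ pairsDifferenceGroup c Y, monomialValue x l = monomialValue y l := by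
  classical
  constructor
  · intro h l hl
    refine monomialValue_eq_of_mem_closure ?_ hl
    intro l hl
    simp only [Set.mem_iUnion, Finset.mem_image] at hl
    obtain ⟨P, ⟨i, hi, rfl⟩, hl⟩ := hl
    exact (psi_eq_iff x y).1 (h i hi) l hl
  · intro h i hi
    exact (psi_eq_iff x y).2 fun l hl => h l (differenceGroup_le_pairsDifferenceGroup hi hl)

theorem mem_commonFiber_iff {Y : Finset (Σ P : AdmissiblePartition f, ReducedTorus P (c P))}
    {x₀ : Torus r} (h₀ : x₀ ∈ commonFiber c Y) (x : Torus r) :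
    x ∈ commonFiber c Y ↔
      ∀ l ∈ pairsDifferenceGroup c Y, monomialValue x l = monomialValue x₀ l := by
  rw [← forall_psi_eq_iff]
  exact forall₂_congr fun i hi => by rw [h₀ i hi]

theorem totalOrderLcm_pos (c : ∀ P : AdmissiblePartition f, BaseChoice P) :
    0 < totalOrderLcm f c :=
  Nat.pos_of_ne_zero fun h => by
    obtain ⟨P, -, hP⟩ := Finset.lcm_eq_zero_iff.1 h
    exact (orderLcm_pos_and_dvd P (c P)).1.ne' hP

theorem totalMaxOrder_pos (f : Laurent r) : 0 < totalMaxOrder f :=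
  Nat.pos_of_ne_zero fun h => by
    obtain ⟨U, -, hU⟩ := Finset.lcm_eq_zero_iff.1 h
    exact (maxOrderSatQuot_pos _).ne' hU

theorem monomialValue_pow_totalOrderLcm
    {Y : Finset (Σ P : AdmissiblePartition f, ReducedTorus P (c P))}
    (hY : Y ⊆ allTorsionSolutions c) {x : Torus r} (hx : x ∈ commonFiber c Y) {l : Fin r → ℤ}
    (hl : l ∈ pairsDifferenceGroup c Y) : monomialValue x l ^ totalOrderLcm f c = 1 := by
  rw [← monomialValue_pow, ← monomialValue_one l]
  refine (forall_psi_eq_iff _ _).1 (fun i hi => ?_) l hl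
  rw [psi_pow, psi_one, hx i hi]
  refine orderOf_dvd_iff_pow_eq_one.1 ?_
  exact ((orderLcm_pos_and_dvd _ _).2 _ ((mem_allTorsionSolutions c).1 (hY hi))).trans
    (Finset.dvd_lcm (f := fun P => orderLcm P (c P)) (Finset.mem_univ i.1))

/-- The number of `n`-torsion points in a common fiber. -/
theorem exists_torsion_count_commonFiber
    {Y : Finset (Σ P : AdmissiblePartition f, ReducedTorus P (c P))}
    (hY : Y ⊆ allTorsionSolutions c) :
    ∃ g : ℕ → ℕ, Function.Periodic g (totalOrderLcm f c * totalMaxOrder f) ∧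
      (∀ n, g n ≠ 0 → (commonFiber c Y).Nonempty) ∧
      ((commonFiber c Y).Nonempty → g 0 ≠ 0) ∧
      ∀ n, 0 < n → Nat.card {x : Torus r // x ∈ commonFiber c Y ∧ x ^ n = 1} =
        g n * n ^ (r - rank (saturation (pairsDifferenceGroup c Y))) := by
  classical
  set E := pairsDifferenceGroup c Y
  obtain ⟨g₀, hper, hpos, hcount⟩ := exists_torsion_count_subgroupLocus E
  have hD : maxOrderSatQuot E ∣ totalMaxOrder f :=
    Finset.dvd_lcm (f := fun U => maxOrderSatQuot (differenceGroupOfSet U)) (Finset.mem_univ _)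
  have hmove : ∀ n n' : ℕ, n ≡ n' [MOD totalOrderLcm f c * totalMaxOrder f] →
      (∃ x ∈ commonFiber c Y, x ^ n = 1) → ∃ x ∈ commonFiber c Y, x ^ n' = 1 := by
    rintro n n' hn ⟨x, hx, hxn⟩
    obtain ⟨x', hx', h⟩ := exists_pow_eq_one_of_modEq
      (fun l hl => monomialValue_pow_totalOrderLcm hY hx hl) hxn
      (hn.of_dvd (Nat.mul_dvd_mul_left _ hD))
    exact ⟨x', (mem_commonFiber_iff hx x').2 h, hx'⟩
  refine ⟨fun n => if ∃ x ∈ commonFiber c Y, x ^ n = 1 then g₀ n else 0, ?_, ?_, ?_, ?_⟩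
  · intro n
    have hmod : n ≡ n + totalOrderLcm f c * totalMaxOrder f
        [MOD totalOrderLcm f c * totalMaxOrder f] := by simp [Nat.ModEq]
    have h1 : g₀ (n + totalOrderLcm f c * totalMaxOrder f) = g₀ n := by
      obtain ⟨q, hq⟩ := hD
      rw [hq, show totalOrderLcm f c * (maxOrderSatQuot E * q) =
        (totalOrderLcm f c * q) * maxOrderSatQuot E by ring]
      exact periodic_nat_mul hper _ n
    exact if_congr ⟨hmove _ _ hmod.symm, hmove _ _ hmod⟩ h1 rfl
  · intro n hn
    by_contra hempty
    exact hn (if_neg fun ⟨x, hx, _⟩ => hempty ⟨x, hx⟩)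
  · rintro ⟨x, hx⟩
    exact (if_pos ⟨x, hx, pow_zero x⟩).trans_ne (hpos 0).ne'
  · intro n hn
    dsimp only
    split_ifs with h
    · obtain ⟨x₀, hx₀, hx₀n⟩ := h
      rw [← hcount n hn]
      refine Nat.card_congr ((Equiv.mulRight x₀⁻¹).subtypeEquiv fun x => ?_)
      change _ ↔ x * x₀⁻¹ ∈ subgroupLocus E ∧ (x * x₀⁻¹) ^ n = 1
      rw [mem_commonFiber_iff hx₀, ← div_eq_mul_inv, div_pow, hx₀n, div_one]
      refine and_congr_left fun _ => forall₂_congr fun l _ => ?_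
      rw [monomialValue_div, div_eq_one]
    · rw [zero_mul, Nat.card_eq_zero]
      exact Or.inl ⟨fun x => h ⟨x.1, x.2.1, x.2.2⟩⟩

theorem finite_setOf_pow_eq_one {n : ℕ} (hn : 0 < n) : {x : Torus r | x ^ n = 1}.Finite := by
  have h : {u : ℂˣ | u ^ n = 1}.Finite := Nat.finite_of_card_ne_zero (by
    change Nat.card {u : ℂˣ // u ^ n = 1} ≠ 0
    rw [card_units_pow_eq_one hn]
    exact hn.ne')
  exact (Set.Finite.pi' fun _ => h).subset fun x hx i => congrFun hx i

variable (c) in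
/-- Inclusion-exclusion for the torsion points of `V(f)`, covered by the fibers of the `psi_P`. -/
theorem exists_torsionCount_hypersurface_eq_sum :
    ∃ F : Finset (Finset (Σ P : AdmissiblePartition f, ReducedTorus P (c P))),
      (∀ Y ∈ F, Y ⊆ allTorsionSolutions c ∧ Y.Nonempty) ∧
      ∀ n, 0 < n → (torsionCount (hypersurface f) n : ℤ) =
        ∑ Y : F, (-1) ^ (Y.1.card + 1) *
          (Nat.card {x : Torus r // x ∈ commonFiber c Y.1 ∧ x ^ n = 1} : ℤ) := by
  classical
  refine ⟨(allTorsionSolutions c).powerset.filter (·.Nonempty), fun Y hY =>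
    ⟨Finset.mem_powerset.1 (Finset.mem_filter.1 hY).1, (Finset.mem_filter.1 hY).2⟩,
    fun n hn => ?_⟩
  set T := (finite_setOf_pow_eq_one (r := r) hn).toFinset
  let S : (Σ P : AdmissiblePartition f, ReducedTorus P (c P)) → Finset (Torus r) := fun i =>
    T.filter fun x => psi i.1 (c i.1) x = i.2
  have hTmem : ∀ x, x ∈ T ↔ x ^ n = 1 := fun x => Set.Finite.mem_toFinset _
  have h1 : torsionCount (hypersurface f) n = ((allTorsionSolutions c).biUnion S).card := by
    rw [torsionCount, ← Nat.card_eq_finsetCard]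
    refine Nat.card_congr (Equiv.subtypeEquivRight fun x => ?_)
    simp only [Finset.mem_biUnion, S, Finset.mem_filter, hTmem, mem_allTorsionSolutions]
    constructor
    · rintro ⟨hx, hxn⟩
      obtain ⟨P, hP⟩ := exists_psi_mem_of_mem_hypersurface c hx
        (isOfFinOrder_iff_pow_eq_one.2 ⟨n, hn, hxn⟩)
      exact ⟨⟨P, _⟩, hP, hxn, rfl⟩
    · rintro ⟨i, hi, hxn, hpsi⟩
      rw [← hpsi] at hi
      exact ⟨mem_hypersurface_of_psi_mem hi, hxn⟩
  rw [h1, Finset.inclusion_exclusion_card_biUnion]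
  refine Finset.sum_congr rfl fun t _ => ?_
  obtain ⟨i₀, hi₀⟩ := (Finset.mem_filter.1 t.2).2
  rw [Nat.subtype_card (t.1.inf' (Finset.mem_filter.1 t.2).2 S)]
  intro x
  rw [Finset.mem_inf']
  simp only [S, Finset.mem_filter, hTmem, commonFiber, Set.mem_ofPred_eq]
  exact ⟨fun h => ⟨fun i hi => (h i hi).2, (h i₀ hi₀).1⟩, fun h i hi => ⟨h.2, h.1 i hi⟩⟩

theorem delta_eq_one_of_nonempty_commonFiber
    {Y : Finset (Σ P : AdmissiblePartition f, ReducedTorus P (c P))}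
    (hY : Y ⊆ allTorsionSolutions c) (hne : (commonFiber c Y).Nonempty)
    {i : Σ P : AdmissiblePartition f, ReducedTorus P (c P)} (hi : i ∈ Y) :
    delta i.1 (c i.1) = 1 := by
  obtain ⟨x, hx⟩ := hne
  refine if_pos ⟨x, ?_⟩
  rw [hx i hi]
  exact (mem_allTorsionSolutions c).1 (hY hi)

variable (c) in
/-- The counting function of `V(f)` has an expansion of the expected period and degree. -/
theorem exists_expansion_hypersurface :
    ∃ a : ℕ →₀ (ℕ → ℂ), IsPolynomialPeriodicExpansion (torsionCount (hypersurface f)) a ∧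
      (∀ i, Function.Periodic (a i) (totalOrderLcm f c * totalMaxOrder f)) ∧
      expansionDegree a ≤ (Finset.univ : Finset (AdmissiblePartition f)).sup (fun P =>
          (r - rank (saturation (differenceGroup P))) * delta P (c P)) := by
  classical
  have hK : 0 < totalOrderLcm f c * totalMaxOrder f :=
    Nat.mul_pos (totalOrderLcm_pos c) (totalMaxOrder_pos f)
  obtain ⟨F, hF, hsum⟩ := exists_torsionCount_hypersurface_eq_sum c
  choose g hper hne _ hcount using fun t : F => exists_torsion_count_commonFiber (hF t.1 t.2).1
  obtain ⟨a, ha, haper, hasupp⟩ := exists_expansion_of_sum (p := torsionCount (hypersurface f))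
    (g := fun t n => (-1 : ℂ) ^ (t.1.card + 1) * (g t n : ℂ))
    (k := fun t => r - rank (saturation (pairsDifferenceGroup c t.1))) hK
    (fun t n => by dsimp only; rw [hper t n]) (fun n hn => by
      have h := congrArg (Int.cast : ℤ → ℂ) (hsum n hn)
      push_cast at h
      rw [h]
      refine Finset.sum_congr rfl fun t _ => ?_
      rw [hcount t n hn]
      push_cast
      ring)
  refine ⟨a, ha, haper, Finset.sup_le fun i hi => ?_⟩
  obtain ⟨t, n, rfl, hgn⟩ := hasupp i hi
  have hg0 : g t n ≠ 0 := by
    intro h0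
    rw [h0, Nat.cast_zero, mul_zero] at hgn
    exact hgn rfl
  obtain ⟨j, hj⟩ := (hF t.1 t.2).2
  refine le_trans ?_ (Finset.le_sup (f := fun P =>
    (r - rank (saturation (differenceGroup P))) * delta P (c P)) (Finset.mem_univ j.1))
  rw [delta_eq_one_of_nonempty_commonFiber (hF t.1 t.2).1 (hne t n hg0) hj, mul_one]
  exact Nat.sub_le_sub_left
    (rank_mono (saturation_mono (differenceGroup_le_pairsDifferenceGroup hj))) r

variable (c) in
theorem pow_le_torsionCount {P : AdmissiblePartition f} (hδ : delta P (c P) ≠ 0) (m : ℕ)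
    (hm : 0 < m) : (m * (totalOrderLcm f c * totalMaxOrder f)) ^
        (r - rank (saturation (differenceGroup P))) ≤
      torsionCount (hypersurface f) (m * (totalOrderLcm f c * totalMaxOrder f)) := by
  classical
  obtain ⟨x, hx⟩ : ∃ x : Torus r, psi P (c P) x ∈ torsionSolutions P (c P) := by
    by_contra h
    exact hδ (if_neg h)
  set K := totalOrderLcm f c * totalMaxOrder f
  have hK : 0 < K := Nat.mul_pos (totalOrderLcm_pos c) (totalMaxOrder_pos f)
  have hn : 0 < m * K := Nat.mul_pos hm hK
  obtain ⟨g, hper, -, hg0, hcount⟩ := exists_torsion_count_commonFiber (c := c)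
    (Y := {⟨P, psi P (c P) x⟩})
    (Finset.singleton_subset_iff.2 ((mem_allTorsionSolutions c).2 hx))
  have h0 : g (m * K) ≠ 0 := by
    have h1 := periodic_nat_mul hper m 0
    rw [zero_add] at h1
    rw [h1]
    exact hg0 ⟨x, fun i hi => by rw [Finset.mem_singleton.1 hi]⟩
  have h1 := hcount _ hn
  rw [pairsDifferenceGroup_singleton] at h1
  have hfin : Finite {y : Torus r // y ∈ hypersurface f ∧ y ^ (m * K) = 1} :=
    ((finite_setOf_pow_eq_one hn).subset fun y hy => hy.2 :
      {y : Torus r | y ∈ hypersurface f ∧ y ^ (m * K) = 1}.Finite)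
  calc (m * K) ^ (r - rank (saturation (differenceGroup P)))
      ≤ g (m * K) * (m * K) ^ (r - rank (saturation (differenceGroup P))) :=
        Nat.le_mul_of_pos_left _ (Nat.pos_of_ne_zero h0)
    _ = _ := h1.symm
    _ ≤ _ := Nat.card_le_card_of_injective
        (fun y => ⟨y.1, mem_hypersurface_of_psi_mem (P := P) (c := c P) (by
          rw [y.2.1 _ (Finset.mem_singleton_self _)]; exact hx), y.2.2⟩)
        fun y y' h => Subtype.ext (congrArg (fun z => z.1) h)

end Counting

end

theorem proposition5p3 (r : ℕ) (f : Laurent r)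
    (c : ∀ P : AdmissiblePartition f, BaseChoice P) :
    (∀ Q : Set (Torus r), IsMaximalRationalPlaneIn Q (hypersurface f) →
      ∃ (P : AdmissiblePartition f) (η : Torus r),
        Q = torusTranslate η (subgroupLocus (saturation (differenceGroup P)))) ∧
    (∀ P : AdmissiblePartition f, (torsionSolutions P (c P)).Finite) ∧
    (∃ a : ℕ →₀ (ℕ → ℂ), IsPolynomialPeriodicExpansion (torsionCount (hypersurface f)) a) ∧
    (∀ a : ℕ →₀ (ℕ → ℂ), IsPolynomialPeriodicExpansion (torsionCount (hypersurface f)) a →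
      expansionDegree a =
        (Finset.univ : Finset (AdmissiblePartition f)).sup (fun P =>
          (r - rank (saturation (differenceGroup P))) * delta P (c P)) ∧
      expansionPeriod a ∣ totalOrderLcm f c * totalMaxOrder f) := by
  have hK : 0 < totalOrderLcm f c * totalMaxOrder f :=
    Nat.mul_pos (totalOrderLcm_pos c) (totalMaxOrder_pos f)
  obtain ⟨a, ha, hper, hdeg⟩ := exists_expansion_hypersurface c
  refine ⟨fun Q hQ => exists_eq_translate_of_isMaximalRationalPlaneIn hQ,
    fun P => finite_torsionSolutions P (c P), ⟨a, ha⟩, fun b hb => ?_⟩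
  obtain rfl := expansion_unique ha hb
  refine ⟨le_antisymm hdeg (Finset.sup_le fun P _ => ?_),
    Finset.lcm_dvd fun i _ => leastPeriod_dvd hK (hper i)⟩
  by_cases hδ : ∃ x : Torus r, psi P (c P) x ∈ torsionSolutions P (c P)
  · have h1 : delta P (c P) = 1 := if_pos hδ
    rw [h1, mul_one]
    exact le_expansionDegree ha hK hper fun m hm =>
      pow_le_torsionCount c (h1.trans_ne one_ne_zero) m hm
  · rw [show delta P (c P) = 0 from if_neg hδ, mul_zero]
    exact Nat.zero_le _
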